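/- Let $A\in\mathbb C^{n\times n}$, $u,v\in\mathbb C^n$, $B(\tau)=A+\tau uv^*$, let $m_A$ be the minimal polynomial of $A$, $l=\deg m_A$, let $p_{uv}$ be the polynomial $p_{uv}(\lambda)=m_A(\lambda)\,v^*(\lambda I_n-A)^{-1}u$, and for $t>0$ put $\sigma(A,u,v;t)=\bigcup_{0\le\theta<2\pi}\sigma(A+te^{i\theta}uv^*)$. Suppose that for some $\kappa\in\{0,\dots,l-1\}$ $$v^*u=\dots=v^*A^{\kappa-1}u=0,\qquad v^*A^\kappa u=r_\kappa e^{i\theta_\kappa}\neq0,\quad r_\kappa>0 .$$ Then: (i) $\deg p_{uv}=l-\kappa-1$. There are $R>0$, $K$ and functions $\lambda_1,\dots,\lambda_{\kappa+1},\mu_1,\dots,\mu_{l-\kappa-1}:\mathbb C\to\mathbb C$ such that for $|\tau|>R$ the eigenvalues of $B(\tau)$, counted with algebraic multiplicity, are the $\lambda_j(\tau)$, the $\mu_i(\tau)$ and the $n-l$ zeros of $\det(\lambda I_n-A)/m_A(\lambda)$, and such that for all $r>R$: (ii) as $\tau\to\infty$ in $\mathbb C$, each $\mu_i(\tau)$ converges,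 and the limits are the roots of $p_{uv}$, counted with multiplicity. (iii) For all $\theta\in[0,2\pi)$ and $j=1,\dots,\kappa+1$, $$\Bigl|\lambda_j(re^{i\theta})-(r r_\kappa)^{\frac1{\kappa+1}}e^{i\left(\frac{\theta+\theta_\kappa}{\kappa+1}+\frac{2j\pi}{\kappa+1}\right)}\Bigr|\le K,$$ and $\lambda_j$ is complex differentiable at $\tau=re^{i\theta}$ (for $\theta=0$: along the closed upper half-plane) with $$\Bigl|\frac{d\lambda_j}{d\tau}-\frac{v^*A^\kappa u}{(\kappa+1)\lambda_j^{\kappa}}\Bigr|\le K|\lambda_j|^{-(\kappa+1)} .$$ The set $\{\lambda_j(re^{i\theta}):1\le j\le\kappa+1,\ 0\le\theta<2\pi\}$ is traced out by a simple closed curve $\Gamma_{\infty,r}:[0,2\pi]\to\mathbb C$ with $|\Gamma_{\infty,r}(\theta)-(rr_\kappa)^{1/(\kappa+1)}e^{i\theta}|\le K$ for all $\theta$. (iv) As $\theta\to2\pi^-$, $\lambda_j(re^{i\theta})\to\lambda_{j+1}(r)$ for $j=1,\dots,\kappa$, and $\lambda_{\kappa+1}(re^{i\theta})\to\lambda_1(r)$.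 (v) For every root $\zeta$ of $p_{uv}$ that is not an eigenvalue of $A$, let $k$ be its multiplicity and $\rho=|v^*(\zeta I_n-A)^{-(k+1)}u|$. Then $\rho>0$, and the set of all $\mu_i(re^{i\theta})$ with $\lim_{\tau\to\infty}\mu_i(\tau)=\zeta$, $0\le\theta<2\pi$, is traced out by a simple closed curve $\Gamma_{\zeta,r}:[0,2\pi]\to\mathbb C$ with $$\bigl|\Gamma_{\zeta,r}(\theta)-\zeta-r^{-1/k}\rho^{-1/k}e^{i\theta}\bigr|\le K r^{-2/k}\quad\text{for all }\theta .$$ The curves $\Gamma_{\infty,r}$ and $\Gamma_{\zeta,r}$ are pairwise disjoint, and $\sigma(A,u,v;r)$ is the union of these curves, the zeros of $\det(\lambda I_n-A)/m_A(\lambda)$, and the $\mu_i(re^{i\theta})$, $0\le\theta<2\pi$, whose limit as $\tau\to\infty$ is an eigenvalue of $A$ (there are none of the last kind if $p_{uv}$ and $m_A$ have no common root). -/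

import Mathlib

open Matrix Polynomial Filter Topology Set

noncomputable section

/-- The number `v* M u`. -/
def starForm {n : ℕ} (v : Fin n → ℂ) (M : Matrix (Fin n) (Fin n) ℂ) (u : Fin n → ℂ) : ℂ :=
  star v ⬝ᵥ (M *ᵥ u)

/-- The rank one perturbation `B(τ) = A + τ u v*`. -/
def rankOnePert {n : ℕ} (A : Matrix (Fin n) (Fin n) ℂ) (u v : Fin n → ℂ) (τ : ℂ) :
    Matrix (Fin n) (Fin n) ℂ :=
  A + τ • vecMulVec u (star v)

/-- The resolvent `(z I - A)⁻¹`. -/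
def resolventAt {n : ℕ} (A : Matrix (Fin n) (Fin n) ℂ) (z : ℂ) : Matrix (Fin n) (Fin n) ℂ :=
  (z • (1 : Matrix (Fin n) (Fin n) ℂ) - A)⁻¹

/-- `m_A(z) v* (z I - A)⁻¹ u` is a polynomial in `z`. -/
theorem exists_puv {n : ℕ} (A : Matrix (Fin n) (Fin n) ℂ) (u v : Fin n → ℂ) :
    ∃ p : ℂ[X], ∀ z : ℂ, z ∉ spectrum ℂ A →
      p.eval z = (minpoly ℂ A).eval z * starForm v (resolventAt A z) u := by
  refine ⟨∑ k ∈ Finset.range ((minpoly ℂ A).natDegree + 1), ∑ i ∈ Finset.range k,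
    C ((minpoly ℂ A).coeff k * starForm v (A ^ (k - 1 - i)) u) * X ^ i, ?_⟩
  intro z hz
  set m := minpoly ℂ A with hm
  have hu : IsUnit (z • (1 : Matrix (Fin n) (Fin n) ℂ) - A) := by
    have := spectrum.notMem_iff.mp hz
    rwa [Algebra.algebraMap_eq_smul_one] at this
  have hdet := (Matrix.isUnit_iff_isUnit_det _).mp hu
  set q : Matrix (Fin n) (Fin n) ℂ := ∑ k ∈ Finset.range (m.natDegree + 1),
    m.coeff k • ∑ i ∈ Finset.range k, (z • (1 : Matrix (Fin n) (Fin n) ℂ)) ^ i * A ^ (k - 1 - i)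
    with hq
  have hmul : (z • (1 : Matrix (Fin n) (Fin n) ℂ) - A) * q = m.eval z • 1 := by
    have hA : aeval A m = 0 := minpoly.aeval ℂ A
    rw [aeval_eq_sum_range] at hA
    rw [hq, Finset.mul_sum]
    have hc : Commute (z • (1 : Matrix (Fin n) (Fin n) ℂ)) A :=
      (Commute.one_left A).smul_left z
    calc _ = ∑ k ∈ Finset.range (m.natDegree + 1),
          m.coeff k • ((z • (1 : Matrix (Fin n) (Fin n) ℂ)) ^ k - A ^ k) := by
          refine Finset.sum_congr rfl fun k _ => ?_
          rw [mul_smul_comm, hc.mul_geom_sum₂]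
      _ = _ := by
          simp only [smul_sub, Finset.sum_sub_distrib, hA, sub_zero, _root_.smul_pow, one_pow]
          rw [eval_eq_sum_range, Finset.sum_smul]
          simp [smul_smul]
  have hq2 : q = m.eval z • resolventAt A z := by
    have := congrArg (fun M => (z • (1 : Matrix (Fin n) (Fin n) ℂ) - A)⁻¹ * M) hmul
    simp only [← mul_assoc, Matrix.nonsing_inv_mul _ hdet, one_mul] at this
    simpa [resolventAt] using this
  have h1 : m.eval z * starForm v (resolventAt A z) u = starForm v q u := by
    rw [hq2, starForm, starForm, smul_mulVec, dotProduct_smul, smul_eq_mul]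
  rw [h1, hq, eval_finsetSum]
  simp only [starForm, sum_mulVec, dotProduct_sum, smul_mulVec, dotProduct_smul, smul_eq_mul,
    eval_finsetSum, eval_mul, eval_C, eval_pow, eval_X, _root_.smul_pow, one_pow, smul_mul_assoc,
    one_mul, Finset.mul_sum]
  refine Finset.sum_congr rfl fun k _ => Finset.sum_congr rfl fun i _ => by ring

/-- The polynomial `p_{uv}(z) = v* m_A(z) (z I - A)⁻¹ u`. -/
def puv {n : ℕ} (A : Matrix (Fin n) (Fin n) ℂ) (u v : Fin n → ℂ) : ℂ[X] :=
  Classical.choose (exists_puv A u v)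

theorem puv_spec {n : ℕ} (A : Matrix (Fin n) (Fin n) ℂ) (u v : Fin n → ℂ) :
    ∀ z : ℂ, z ∉ spectrum ℂ A →
      (puv A u v).eval z = (minpoly ℂ A).eval z * starForm v (resolventAt A z) u :=
  Classical.choose_spec (exists_puv A u v)

theorem puv_unique {n : ℕ} (A : Matrix (Fin n) (Fin n) ℂ) (u v : Fin n → ℂ) (p : ℂ[X])
    (hp : ∀ z : ℂ, z ∉ spectrum ℂ A →
      p.eval z = (minpoly ℂ A).eval z * starForm v (resolventAt A z) u) : p = puv A u v := by
  have hfin : (spectrum ℂ A).Finite := Matrix.finite_spectrum A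
  refine Polynomial.eq_of_infinite_eval_eq _ _ (hfin.infinite_compl.mono ?_)
  intro z hz
  simp only [Set.mem_ofPred_eq]
  rw [hp z hz, puv_spec A u v z hz]

/-- The point `r e^{iθ}`. -/
def polarPt (r θ : ℝ) : ℂ := (r : ℂ) * Complex.exp (θ * Complex.I)

/-- `σ(A,u,v;t)`, the union of the spectra of `A + t e^{iθ} u v*` over `0 ≤ θ < 2π`. -/
def sigmaSet {n : ℕ} (A : Matrix (Fin n) (Fin n) ℂ) (u v : Fin n → ℂ) (t : ℝ) : Set ℂ :=
  ⋃ θ ∈ Ico (0 : ℝ) (2 * Real.pi), spectrum ℂ (rankOnePert A u v (polarPt t θ))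

/-- The set traced out by a curve with parameter interval `[0, 2π]`. -/
def curveTrace (γ : ℝ → ℂ) : Set ℂ := γ '' Icc (0 : ℝ) (2 * Real.pi)

/-- `γ`, restricted to `[0, 2π]`, is a simple closed curve. -/
def IsSimpleClosedCurve (γ : ℝ → ℂ) : Prop :=
  ContinuousOn γ (Icc (0 : ℝ) (2 * Real.pi)) ∧ γ 0 = γ (2 * Real.pi) ∧
    InjOn γ (Ico (0 : ℝ) (2 * Real.pi))

/-- The roots of `p_{uv}` which are not eigenvalues of `A`. -/
def freeRoots {n : ℕ} (A : Matrix (Fin n) (Fin n) ℂ) (u v : Fin n → ℂ) : Set ℂ :=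
  {ζ | ζ ∈ (puv A u v).roots ∧ ζ ∉ spectrum ℂ A}

/-- The modulus `ρ` of `v* (ζ I - A)^{-(k+1)} u`, with `k` the multiplicity of `ζ` as a root of
`p_{uv}`. -/
def rhoAt {n : ℕ} (A : Matrix (Fin n) (Fin n) ℂ) (u v : Fin n → ℂ) (ζ : ℂ) : ℝ :=
  ‖starForm v (resolventAt A ζ ^ ((puv A u v).rootMultiplicity ζ + 1)) u‖

end

/-!
By the matrix determinant lemma, `det (z - B(τ)) = (det (z - A) / m(z)) (m(z) - τ p(z))`, with `m`
the minimal polynomial of `A` and `p = p_{uv}` (`charpoly_rankOnePert`). So the eigenvalues that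
move with `τ` solve `m = τ p`. The identity
`m(z) - m(A) = (z - A) ∑ₖ mₖ ∑_{i < k} zⁱ A ^ (k - 1 - i)` gives the coefficients of `p`
(`puv_eq_sum`), hence its degree `l - κ - 1` and its leading coefficient `w = v* A ^ κ u`. After
splitting off `g = gcd (m, p)`, whose roots do not depend on `τ`, coprime polynomials `a`, `b` with
`deg a = deg b + κ + 1` remain, and the equation becomes `b / a = 1 / τ`.

The quotient `b / a` vanishes to order `k` at each root `ζ` of `b` of multiplicity `k`, and to order
`κ + 1` at infinity. An analytic change of coordinate tangent to the identity turns a zero of order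
`k` into `x ↦ c x ^ k` (`exists_power_normal_form`). In this coordinate the equation reads
`c x ^ k = 1 / τ`, which is solved by the explicit branches `rootBranch` of the `k`-th root. Each
such point therefore gives `k` distinct solutions (`exists_bounded_branches`,
`exists_large_branches`). Over the circle `|τ| = r` the coordinates of these solutions sweep out a
circle, and its image under the injective coordinate map is the closed curve in question. Altogether
these are `deg a` distinct roots of `a - τ b`, hence all of them (`exists_solution_branches`), so
that no separate argument on the continuity of roots is needed.

Each linear factor `z - ζ` of `p`, with `ζ` not an eigenvalue, can be removed by replacing `u` by
`-(ζ - A)⁻¹ u` (`puv_eq_mul_of_isRoot`); this identifies the constant `|c|` at `ζ` with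
`|v* (ζ - A)^{-(k + 1)} u|` (`norm_div_eq_rhoAt`).
-/

/-! ### Local normal forms -/

theorem hasDerivAt_id_mul {q : ℂ → ℂ} (hq : DifferentiableAt ℂ q 0) :
    HasDerivAt (fun x => x * q x) (q 0) 0 := by
  have h := (hasDerivAt_id (0 : ℂ)).mul hq.hasDerivAt
  exact h.congr_deriv (by simp)

/-- Near `0`, the function `y ↦ y ^ k * g y` with `g 0 ≠ 0` becomes `x ↦ g 0 * x ^ k` after the
analytic change of variable `y = x * q x`, which is tangent to the identity. -/
theorem exists_power_normal_form {g : ℂ → ℂ} (hg : AnalyticAt ℂ g 0) (h0 : g 0 ≠ 0) {k : ℕ}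
    (hk : k ≠ 0) : ∃ q : ℂ → ℂ, AnalyticAt ℂ q 0 ∧ q 0 = 1 ∧
      ∀ᶠ x in 𝓝 (0 : ℂ), (x * q x) ^ k * g (x * q x) = g 0 * x ^ k := by
  have hkC : (k : ℂ) ≠ 0 := Nat.cast_ne_zero.mpr hk
  -- `h` is the `k`-th root of `g / g 0` with `h 0 = 1`
  set h : ℂ → ℂ := fun y => Complex.exp (Complex.log (g y / g 0) / k) with hh
  have hgd : AnalyticAt ℂ (fun y => g y / g 0) 0 := hg.div analyticAt_const h0
  have hh0 : h 0 = 1 := by simp [hh, h0]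
  have hha : AnalyticAt ℂ h 0 := by
    refine AnalyticAt.cexp ?_
    exact AnalyticAt.div (hgd.clog (by simp [h0])) analyticAt_const hkC
  have hpow : ∀ᶠ y in 𝓝 (0 : ℂ), g 0 * h y ^ k = g y := by
    have : ∀ᶠ y in 𝓝 (0 : ℂ), g y ≠ 0 := hg.continuousAt.eventually_ne h0
    filter_upwards [this] with y hy
    simp only [hh]
    rw [← Complex.exp_nat_mul, mul_div_cancel₀ _ hkC, Complex.exp_log (div_ne_zero hy h0)]
    field_simp
  set H : ℂ → ℂ := fun y => y * h y with hH
  have hHa : AnalyticAt ℂ H 0 := analyticAt_id.mul hha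
  have hHd : HasDerivAt H 1 0 := hh0 ▸ hasDerivAt_id_mul hha.differentiableAt
  have hder : deriv H 0 ≠ 0 := by rw [hHd.deriv]; exact one_ne_zero
  have hH0 : H 0 = 0 := by simp [hH]
  set φ := hHa.hasStrictDerivAt.localInverse _ _ _ hder with hφ
  have hφa : AnalyticAt ℂ φ 0 := by simpa [hH0] using hHa.analyticAt_localInverse hder
  have hφ0 : φ 0 = 0 := by
    have := HasStrictFDerivAt.localInverse_apply_image
      (hHa.hasStrictDerivAt.hasStrictFDerivAt_equiv hder)
    rw [hH0] at this
    exact this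
  have hφd : HasDerivAt φ 1 0 := by
    have := (hHa.hasStrictDerivAt.to_localInverse hder).hasDerivAt
    rw [hH0] at this
    exact this.congr_deriv (by rw [hHd.deriv, inv_one])
  have hright : ∀ᶠ x in 𝓝 (0 : ℂ), H (φ x) = x := by
    have := HasStrictFDerivAt.eventually_right_inverse
      (hHa.hasStrictDerivAt.hasStrictFDerivAt_equiv hder)
    rw [hH0] at this
    exact this
  obtain ⟨p, hp⟩ := hφa
  have hmul : ∀ x, x * dslope φ 0 x = φ x := fun x => by
    have := sub_smul_dslope φ 0 x
    simpa [hφ0] using this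
  refine ⟨dslope φ 0, hp.has_fpower_series_dslope_fslope.analyticAt, ?_, ?_⟩
  · rw [dslope_same, hφd.deriv]
  · have ht : Tendsto φ (𝓝 0) (𝓝 0) := by
      simpa [hφ0] using hp.analyticAt.continuousAt.tendsto
    filter_upwards [hright, ht.eventually hpow] with x hx1 hx2
    rw [hmul, ← hx2]
    have : (φ x * h (φ x)) ^ k = x ^ k := by rw [show φ x * h (φ x) = x from hx1]
    rw [← this]
    ring

/-- An analytic function with nonzero derivative is injective near the point. -/
theorem AnalyticAt.exists_injOn {f : ℂ → ℂ} {z : ℂ} (hf : AnalyticAt ℂ f z)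
    (hd : deriv f z ≠ 0) : ∃ s ∈ 𝓝 z, InjOn f s := by
  have := HasStrictFDerivAt.eventually_left_inverse
    (hf.hasStrictDerivAt.hasStrictFDerivAt_equiv hd)
  refine ⟨_, this, fun x hx y hy hxy => ?_⟩
  rw [← show _ = x from hx, ← show _ = y from hy, hxy]

/-- A function analytic at `0` satisfies `f x = f 0 + O(x)`. -/
theorem AnalyticAt.exists_bound {f : ℂ → ℂ} (hf : AnalyticAt ℂ f 0) :
    ∃ C : ℝ, 0 < C ∧ ∀ᶠ x in 𝓝 (0 : ℂ), ‖f x - f 0‖ ≤ C * ‖x‖ := by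
  have := hf.differentiableAt.isBigO_sub
  obtain ⟨C, hC, h⟩ := this.exists_pos
  exact ⟨C, hC, by simpa using h.bound⟩

/-- Local solution of `b z / a z = c * x ^ k` near a zero `ζ` of order `k` of the polynomial `b`. -/
theorem exists_chart_at_root {a b : ℂ[X]} {ζ : ℂ} (ha : a.eval ζ ≠ 0) (hb : b ≠ 0)
    (hζ : b.IsRoot ζ) {U : Set ℂ} (hU : U ∈ 𝓝 ζ) :
    ∃ c : ℂ, c = (b /ₘ (X - C ζ) ^ b.rootMultiplicity ζ).eval ζ / a.eval ζ ∧ c ≠ 0 ∧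
    ∃ (ψ : ℂ → ℂ) (δ C : ℝ), 0 < δ ∧ 0 < C ∧ ψ 0 = ζ ∧ ContinuousOn ψ (Metric.ball 0 δ) ∧
      InjOn ψ (Metric.ball 0 δ) ∧ MapsTo ψ (Metric.ball 0 δ) U ∧
      (∀ x ∈ Metric.ball (0 : ℂ) δ,
        b.eval (ψ x) = c * x ^ b.rootMultiplicity ζ * a.eval (ψ x)) ∧
      ∀ x ∈ Metric.ball (0 : ℂ) δ, ‖ψ x - (ζ + x)‖ ≤ C * ‖x‖ ^ 2 := by
  set k := b.rootMultiplicity ζ with hk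
  set b' := b /ₘ (X - Polynomial.C ζ) ^ k with hb'
  have hk0 : k ≠ 0 := ((rootMultiplicity_pos hb).mpr hζ).ne'
  have hb'0 : b'.eval ζ ≠ 0 := eval_divByMonic_pow_rootMultiplicity_ne_zero ζ hb
  have hbb : ∀ z, b.eval z = (z - ζ) ^ k * b'.eval z := fun z => by
    conv_lhs => rw [← pow_mul_divByMonic_rootMultiplicity_eq b ζ]
    simp [← hk, ← hb']
  have hpa : ∀ p : ℂ[X], ∀ z, AnalyticAt ℂ (fun x => p.eval (z + x)) 0 := fun p z =>
    Differentiable.analyticAt (p.differentiable.comp (differentiable_id.const_add z)) 0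
  set g : ℂ → ℂ := fun y => b'.eval (ζ + y) / a.eval (ζ + y) with hg
  have hga : AnalyticAt ℂ g 0 := (hpa b' ζ).div (hpa a ζ) (by simpa using ha)
  have hg0 : g 0 = b'.eval ζ / a.eval ζ := by simp [hg]
  have hg0' : g 0 ≠ 0 := by rw [hg0]; exact div_ne_zero hb'0 ha
  refine ⟨_, rfl, div_ne_zero hb'0 ha, ?_⟩
  obtain ⟨q, hqa, hq0, hq⟩ := exists_power_normal_form hga hg0' hk0
  set ψ : ℂ → ℂ := fun x => ζ + x * q x with hψ
  have hψa : AnalyticAt ℂ ψ 0 := analyticAt_const.add (analyticAt_id.mul hqa)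
  have hψ0 : ψ 0 = ζ := by simp [hψ]
  have hψd : HasDerivAt ψ 1 0 := (hq0 ▸ hasDerivAt_id_mul hqa.differentiableAt).const_add ζ
  obtain ⟨s, hs, hinj⟩ := hψa.exists_injOn (by rw [hψd.deriv]; exact one_ne_zero)
  obtain ⟨C, hC, hbd⟩ := hqa.exists_bound
  have haψ : ∀ᶠ x in 𝓝 (0 : ℂ), a.eval (ψ x) ≠ 0 :=
    (a.continuous.continuousAt.comp hψa.continuousAt).eventually_ne (by simpa [hψ0] using ha)
  have hUψ : ∀ᶠ x in 𝓝 (0 : ℂ), ψ x ∈ U :=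
    hψa.continuousAt.eventually_mem (by rwa [hψ0])
  have hall := (eventually_mem_set.mpr hs).and (hbd.and (haψ.and (hUψ.and
    (hq.and hψa.eventually_analyticAt))))
  obtain ⟨δ, hδ, hball⟩ := Metric.eventually_nhds_iff_ball.mp hall
  refine ⟨ψ, δ, C, hδ, hC, hψ0, fun x hx => (hball x hx).2.2.2.2.2.continuousAt.continuousWithinAt,
    hinj.mono fun x hx => (hball x hx).1, fun x hx => (hball x hx).2.2.2.1, fun x hx => ?_,
    fun x hx => ?_⟩
  · obtain ⟨_, _, h3, _, h5, _⟩ := hball x hx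
    have h6 : g (x * q x) = b'.eval (ψ x) / a.eval (ψ x) := rfl
    rw [← hg0, ← h5, h6, hbb, mul_assoc, div_mul_cancel₀ _ h3]
    simp [hψ]
  · obtain ⟨_, h2, _⟩ := hball x hx
    have : ψ x - (ζ + x) = x * (q x - q 0) := by simp only [hψ, hq0]; ring
    rw [this, norm_mul]
    calc _ ≤ ‖x‖ * (C * ‖x‖) := by gcongr
      _ = _ := by ring

/-- Local solution of `b z / a z = c * (1 / s) ^ (κ + 1)` near infinity, where
`κ + 1 = deg a - deg b`, together with the asymptotics of the solution and of its derivative. -/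
theorem exists_chart_at_infinity {a b : ℂ[X]} (hb : b ≠ 0) {κ : ℕ}
    (hdeg : a.natDegree = b.natDegree + (κ + 1)) (M : ℝ) :
    ∃ (ψ ψ' : ℂ → ℂ) (T C : ℝ), 0 < T ∧ 0 < C ∧
      (∀ s, T < ‖s‖ → HasDerivAt ψ (ψ' s) s) ∧
      InjOn ψ {s | T < ‖s‖} ∧ (∀ s, T < ‖s‖ → M < ‖ψ s‖) ∧
      (∀ s, T < ‖s‖ → b.eval (ψ s) * s ^ (κ + 1) =
        b.leadingCoeff / a.leadingCoeff * a.eval (ψ s)) ∧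
      (∀ s, T < ‖s‖ → ‖ψ s - s‖ ≤ C) ∧
      ∀ s, T < ‖s‖ → ‖ψ' s / s ^ κ - 1 / ψ s ^ κ‖ ≤ C * (‖ψ s‖ ^ (κ + 1))⁻¹ := by
  have ha : a ≠ 0 := by rintro rfl; simp at hdeg
  -- in the coordinate `y = 1 / z`, the quotient `b / a` is `y ^ (κ + 1)` times the quotient of the
  -- reversed polynomials, which is analytic and nonzero at `y = 0`
  have hrev : ∀ p : ℂ[X], ∀ y : ℂ, y ≠ 0 → p.eval y⁻¹ * y ^ p.natDegree = p.reverse.eval y := by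
    intro p y hy
    have : Invertible y⁻¹ := invertibleOfNonzero (inv_ne_zero hy)
    have h := eval₂_reverse_mul_pow (RingHom.id ℂ) y⁻¹ p
    rw [invOf_eq_inv, inv_inv] at h
    simp only [eval₂_id] at h
    rw [← h, mul_assoc, ← mul_pow, inv_mul_cancel₀ hy, one_pow, mul_one]
  have hpa : ∀ p : ℂ[X], AnalyticAt ℂ (fun x => p.eval x) 0 := fun p =>
    Differentiable.analyticAt p.differentiable 0
  set g : ℂ → ℂ := fun y => b.reverse.eval y / a.reverse.eval y with hg
  have hr0 : ∀ p : ℂ[X], p.reverse.eval 0 = p.leadingCoeff := fun p => by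
    rw [← coeff_zero_eq_eval_zero, coeff_zero_reverse]
  have har : a.reverse.eval 0 ≠ 0 := by rw [hr0]; exact leadingCoeff_ne_zero.mpr ha
  have hga : AnalyticAt ℂ g 0 := (hpa _).div (hpa _) har
  have hg0 : g 0 = b.leadingCoeff / a.leadingCoeff := by simp only [hg, hr0]
  have hg0' : g 0 ≠ 0 := by
    rw [hg0]; exact div_ne_zero (leadingCoeff_ne_zero.mpr hb) (leadingCoeff_ne_zero.mpr ha)
  obtain ⟨q, hqa, hq0, hq⟩ := exists_power_normal_form hga hg0' (Nat.succ_ne_zero κ)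
  set φ : ℂ → ℂ := fun x => x * q x with hφ
  have hφa : AnalyticAt ℂ φ 0 := analyticAt_id.mul hqa
  have hφ0 : φ 0 = 0 := by simp [hφ]
  have hφd : HasDerivAt φ 1 0 := hq0 ▸ hasDerivAt_id_mul hqa.differentiableAt
  obtain ⟨S, hS, hinj⟩ := hφa.exists_injOn (by rw [hφd.deriv]; exact one_ne_zero)
  have hq00 : q 0 ≠ 0 := by rw [hq0]; exact one_ne_zero
  -- the first bound controls `ψ s - s = s * (1 / q s⁻¹ - 1)`, the second one
  -- `ψ' s / s ^ κ - 1 / ψ s ^ κ = s⁻¹ ^ κ * (deriv φ / q ^ 2 - q ^ κ) s⁻¹`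
  obtain ⟨C₁, hC₁, hb₁⟩ := (hqa.inv hq00).exists_bound
  obtain ⟨C₂, hC₂, hb₂⟩ :=
    ((hφa.deriv.div (hqa.pow 2) (pow_ne_zero 2 hq00)).sub (hqa.pow κ)).exists_bound
  have hqn : ∀ᶠ x in 𝓝 (0 : ℂ), 1 / 2 < ‖q x‖ :=
    hqa.continuousAt.norm.eventually (lt_mem_nhds (by simp only [hq0]; norm_num))
  have haφ : ∀ᶠ x in 𝓝 (0 : ℂ), a.reverse.eval (φ x) ≠ 0 :=
    ((hpa a.reverse).continuousAt.comp_of_eq hφa.continuousAt hφ0).eventually_ne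
      (by simpa [hφ0] using har)
  have hMφ : ∀ᶠ x in 𝓝 (0 : ℂ), ‖φ x‖ < (|M| + 1)⁻¹ :=
    hφa.continuousAt.norm.eventually (gt_mem_nhds (by simp only [hφ0, norm_zero]; positivity))
  have hall := (eventually_mem_set.mpr hS).and (hb₁.and (hb₂.and (hqn.and (haφ.and
    (hMφ.and (hq.and hφa.eventually_analyticAt))))))
  obtain ⟨δ, hδ, hball⟩ := Metric.eventually_nhds_iff_ball.mp hall
  have key : ∀ s : ℂ, δ⁻¹ < ‖s‖ → s ≠ 0 ∧ s⁻¹ ∈ Metric.ball (0 : ℂ) δ := fun s hs => by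
    have h0 : 0 < ‖s‖ := lt_trans (inv_pos.mpr hδ) hs
    refine ⟨norm_pos_iff.mp h0, ?_⟩
    rw [mem_ball_zero_iff, norm_inv]
    exact inv_lt_of_inv_lt₀ hδ hs
  have hqne : ∀ x ∈ Metric.ball (0 : ℂ) δ, q x ≠ 0 := fun x hx h => by
    have := (hball x hx).2.2.2.1
    rw [h, norm_zero] at this; norm_num at this
  refine ⟨fun s => (φ s⁻¹)⁻¹, fun s => deriv φ s⁻¹ / q s⁻¹ ^ 2, δ⁻¹,
    max C₁ (C₂ * 2 ^ (κ + 1)), inv_pos.mpr hδ, lt_max_of_lt_left hC₁, fun s hs => ?_,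
    fun s hs t ht hst => ?_, fun s hs => ?_, fun s hs => ?_, fun s hs => ?_, fun s hs => ?_⟩
  · obtain ⟨h0, hx⟩ := key s hs
    obtain ⟨_, _, _, _, _, _, _, h9⟩ := hball _ hx
    have hqx := hqne _ hx
    have h := (h9.differentiableAt.hasDerivAt.comp s (hasDerivAt_inv h0)).inv
      (by simp only [hφ, Function.comp]; exact mul_ne_zero (inv_ne_zero h0) hqx)
    refine h.congr_deriv ?_
    simp only [hφ, Function.comp]
    field_simp
  · obtain ⟨h0, hx⟩ := key s hs
    obtain ⟨h0', hx'⟩ := key t ht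
    exact inv_injective (hinj (hball _ hx).1 (hball _ hx').1 (inv_injective hst))
  · obtain ⟨h0, hx⟩ := key s hs
    have h7 := (hball _ hx).2.2.2.2.2.1
    have hpos : 0 < ‖φ s⁻¹‖ :=
      norm_pos_iff.mpr (mul_ne_zero (inv_ne_zero h0) (hqne _ hx))
    have := (lt_inv_comm₀ hpos (by positivity)).mp h7
    rw [norm_inv]
    linarith [le_abs_self M]
  · obtain ⟨h0, hx⟩ := key s hs
    obtain ⟨_, _, _, _, h6, _, h8, _⟩ := hball _ hx
    have hφx : φ s⁻¹ ≠ 0 := mul_ne_zero (inv_ne_zero h0) (hqne _ hx)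
    have h8' : φ s⁻¹ ^ (κ + 1) * g (φ s⁻¹) = g 0 * s⁻¹ ^ (κ + 1) := h8
    rw [hg0] at h8'
    simp only [hg] at h8'
    rw [← hrev b _ hφx, ← hrev a _ hφx, hdeg] at h8'
    rw [← hrev a _ hφx] at h6
    have h6' := left_ne_zero_of_mul h6
    have hs1 : s ^ (κ + 1) ≠ 0 := pow_ne_zero _ h0
    rw [inv_pow, pow_add (φ s⁻¹) b.natDegree] at h8'
    have hp1 := pow_ne_zero b.natDegree hφx
    have hp2 := pow_ne_zero (κ + 1) hφx
    have : φ s⁻¹ ^ (κ + 1) * (eval (φ s⁻¹)⁻¹ b * φ s⁻¹ ^ b.natDegree /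
        (eval (φ s⁻¹)⁻¹ a * (φ s⁻¹ ^ b.natDegree * φ s⁻¹ ^ (κ + 1)))) =
        eval (φ s⁻¹)⁻¹ b / eval (φ s⁻¹)⁻¹ a := by
      generalize φ s⁻¹ ^ (κ + 1) = P at *
      generalize φ s⁻¹ ^ b.natDegree = Q at *
      field_simp
    rw [this, div_eq_iff h6'] at h8'
    rw [h8']
    field_simp
  · obtain ⟨h0, hx⟩ := key s hs
    obtain ⟨_, h2, _⟩ := hball _ hx
    have : (φ s⁻¹)⁻¹ - s = s * (q⁻¹ s⁻¹ - q⁻¹ 0) := by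
      simp only [hφ, Pi.inv_apply, hq0, mul_inv, inv_inv, inv_one]; ring
    rw [this, norm_mul]
    refine le_trans ?_ (le_max_left _ _)
    calc _ ≤ ‖s‖ * (C₁ * ‖s⁻¹‖) := by gcongr
      _ = C₁ := by rw [norm_inv]; field_simp [norm_ne_zero_iff.mpr h0]
  · obtain ⟨h0, hx⟩ := key s hs
    obtain ⟨_, _, h3, h4, _⟩ := hball _ hx
    have hE0 : (deriv φ / q ^ 2 - q ^ κ) 0 = 0 := by
      simp [hφd.deriv, hq0]
    rw [hE0, sub_zero] at h3
    have hid : deriv φ s⁻¹ / q s⁻¹ ^ 2 / s ^ κ - 1 / (φ s⁻¹)⁻¹ ^ κ =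
        (s⁻¹) ^ κ * (deriv φ / q ^ 2 - q ^ κ) s⁻¹ := by
      simp only [hφ, Pi.sub_apply, Pi.div_apply, Pi.pow_apply, inv_pow, one_div, inv_inv,
        mul_pow]
      field_simp
    rw [hid, norm_mul, norm_pow, norm_inv (φ s⁻¹), inv_pow, inv_inv]
    calc ‖s⁻¹‖ ^ κ * ‖(deriv φ / q ^ 2 - q ^ κ) s⁻¹‖ ≤ ‖s⁻¹‖ ^ κ * (C₂ * ‖s⁻¹‖) := by gcongr
      _ = C₂ * ‖s⁻¹‖ ^ (κ + 1) := by ring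
      _ ≤ C₂ * (2 * ‖φ s⁻¹‖) ^ (κ + 1) := by
          gcongr
          simp only [hφ, norm_mul]
          nlinarith [norm_nonneg s⁻¹]
      _ = (C₂ * 2 ^ (κ + 1)) * ‖φ s⁻¹‖ ^ (κ + 1) := by rw [mul_pow]; ring
      _ ≤ _ := by gcongr; exact le_max_right _ _

/-! ### Polar coordinates and branches of the `k`-th root -/

theorem norm_polarPt {r : ℝ} (hr : 0 ≤ r) (θ : ℝ) : ‖polarPt r θ‖ = r := by
  rw [polarPt, norm_mul, Complex.norm_exp_ofReal_mul_I, mul_one, Complex.norm_real,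
    Real.norm_of_nonneg hr]

theorem polarPt_zero_right (r : ℝ) : polarPt r 0 = r := by simp [polarPt]

theorem polarPt_mul (r s θ φ : ℝ) : polarPt r θ * polarPt s φ = polarPt (r * s) (θ + φ) := by
  simp only [polarPt, Complex.ofReal_mul, Complex.ofReal_add, add_mul, Complex.exp_add]
  ring

theorem polarPt_pow (r θ : ℝ) (k : ℕ) : polarPt r θ ^ k = polarPt (r ^ k) (k * θ) := by
  simp only [polarPt, mul_pow, ← Complex.exp_nat_mul]
  push_cast
  ring_nf

theorem polarPt_add_int_mul (r θ : ℝ) (n : ℤ) :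
    polarPt r (θ + n * (2 * Real.pi)) = polarPt r θ := by
  simp only [polarPt]
  congr 1
  have : ((θ + n * (2 * Real.pi) : ℝ) : ℂ) * Complex.I =
      θ * Complex.I + n * (2 * Real.pi * Complex.I) := by push_cast; ring
  rw [this, Complex.exp_add, Complex.exp_int_mul_two_pi_mul_I, mul_one]

theorem polarPt_eq_polarPt {r θ φ : ℝ} (hr : 0 < r) (h : polarPt r θ = polarPt r φ) :
    ∃ n : ℤ, θ = φ + n * (2 * Real.pi) := by
  have hr' : (r : ℂ) ≠ 0 := Complex.ofReal_ne_zero.mpr hr.ne'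
  obtain ⟨n, hn⟩ := Complex.exp_eq_exp_iff_exists_int.mp (mul_left_cancel₀ hr' h)
  refine ⟨n, ?_⟩
  have h2 : (θ : ℂ) * Complex.I = (φ + n * (2 * Real.pi)) * Complex.I := by rw [hn]; ring
  have h3 := mul_right_cancel₀ Complex.I_ne_zero h2
  exact_mod_cast h3

theorem continuous_polarPt (r : ℝ) : Continuous (polarPt r) := by
  unfold polarPt; fun_prop

/-- The argument of `τ` normalized to `[0, 2π)`. -/
noncomputable def cutArg (τ : ℂ) : ℝ := toIcoMod Real.two_pi_pos 0 (Complex.arg τ)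

theorem cutArg_mem (τ : ℂ) : cutArg τ ∈ Ico (0 : ℝ) (2 * Real.pi) := by
  have := toIcoMod_mem_Ico Real.two_pi_pos 0 (Complex.arg τ)
  rwa [zero_add] at this

theorem polarPt_cutArg (τ : ℂ) : polarPt ‖τ‖ (cutArg τ) = τ := by
  have h : cutArg τ = Complex.arg τ + (-toIcoDiv Real.two_pi_pos 0 (Complex.arg τ) : ℤ) *
      (2 * Real.pi) := by
    rw [cutArg, toIcoMod, zsmul_eq_mul]; push_cast; ring
  rw [h, polarPt_add_int_mul]
  exact Complex.norm_mul_exp_arg_mul_I τ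

theorem cutArg_polarPt {r θ : ℝ} (hr : 0 < r) (hθ : θ ∈ Ico (0 : ℝ) (2 * Real.pi)) :
    cutArg (polarPt r θ) = θ := by
  have h := polarPt_cutArg (polarPt r θ)
  rw [norm_polarPt hr.le] at h
  obtain ⟨n, hn⟩ := polarPt_eq_polarPt hr h
  have h1 := cutArg_mem (polarPt r θ)
  have hpi := Real.two_pi_pos
  have h2 : (n : ℝ) < 1 := by
    by_contra! hc
    nlinarith [h1.2, hθ.1]
  have h3 : (-1 : ℝ) < n := by
    by_contra! hc
    nlinarith [h1.1, hθ.2]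
  have : n = 0 := by
    have h2' : n < 1 := by exact_mod_cast h2
    have h3' : -1 < n := by exact_mod_cast h3
    omega
  rw [hn, this]; simp

/-- The branches `s` of `s ^ k = ρ e^{iα} τ`, for `j = 0, …, k - 1`, cut along the positive
half-line. -/
noncomputable def rootBranch (k : ℕ) (ρ α : ℝ) (j : ℕ) (τ : ℂ) : ℂ :=
  polarPt ((‖τ‖ * ρ) ^ (1 / (k : ℝ))) ((cutArg τ + α + 2 * Real.pi * (j + 1)) / k)

section rootBranch

variable {k : ℕ} {ρ α : ℝ} {j : ℕ}

theorem norm_rootBranch (hρ : 0 ≤ ρ) (τ : ℂ) :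
    ‖rootBranch k ρ α j τ‖ = (‖τ‖ * ρ) ^ (1 / (k : ℝ)) :=
  norm_polarPt (Real.rpow_nonneg (mul_nonneg (norm_nonneg _) hρ) _) _

theorem rootBranch_pow (hk : k ≠ 0) (hρ : 0 ≤ ρ) (τ : ℂ) :
    rootBranch k ρ α j τ ^ k = polarPt ρ α * τ := by
  have hk' : (k : ℝ) ≠ 0 := Nat.cast_ne_zero.mpr hk
  rw [rootBranch, polarPt_pow, one_div,
    Real.rpow_inv_natCast_pow (mul_nonneg (norm_nonneg _) hρ) hk, mul_div_cancel₀ _ hk']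
  have : cutArg τ + α + 2 * Real.pi * (j + 1) =
      (cutArg τ + α) + ((j + 1 : ℕ) : ℤ) * (2 * Real.pi) := by push_cast; ring
  rw [this, polarPt_add_int_mul, ← polarPt_mul, polarPt_cutArg, mul_comm]

theorem rootBranch_injOn (hρ : 0 < ρ) {τ : ℂ} (hτ : τ ≠ 0) {j' : ℕ} (hj : j < k) (hj' : j' < k)
    (h : rootBranch k ρ α j τ = rootBranch k ρ α j' τ) : j = j' := by
  have hk' : (0 : ℝ) < k := Nat.cast_pos.mpr (by omega)
  obtain ⟨n, hn⟩ := polarPt_eq_polarPt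
    (Real.rpow_pos_of_pos (mul_pos (norm_pos_iff.mpr hτ) hρ) _) h
  have hpi := Real.pi_pos
  have h1 : (j : ℝ) = j' + n * k := by
    field_simp at hn
    have : 2 * Real.pi * ((j : ℝ) - (j' + n * k)) = 0 := by linarith
    have := (mul_eq_zero.mp this).resolve_left (by positivity)
    linarith
  have h2 : (j : ℤ) = j' + n * k := by exact_mod_cast h1
  have : n = 0 := by
    rcases lt_trichotomy n 0 with h | h | h
    · nlinarith
    · exact h
    · nlinarith
  subst this
  simpa using h2

/-- Over the circle of radius `r`, the branches trace out a circle. -/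
theorem rootBranch_image (hk : k ≠ 0) (hρ : 0 < ρ) {r : ℝ} (hr : 0 < r) :
    {s | ∃ j < k, ∃ θ ∈ Ico (0 : ℝ) (2 * Real.pi), s = rootBranch k ρ α j (polarPt r θ)} =
      Metric.sphere (0 : ℂ) ((r * ρ) ^ (1 / (k : ℝ))) := by
  have hk' : (0 : ℝ) < k := Nat.cast_pos.mpr (Nat.pos_of_ne_zero hk)
  ext s
  simp only [mem_ofPred_eq, mem_sphere_zero_iff_norm]
  constructor
  · rintro ⟨j, _, θ, _, rfl⟩
    rw [norm_rootBranch hρ.le, norm_polarPt hr.le]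
  · intro hs
    -- write `k arg s - α = θ + 2πN` with `θ ∈ [0, 2π)`, and `N - 1 = j + k Q` with `0 ≤ j < k`
    set γ := k * Complex.arg s - α with hγ
    set N := toIcoDiv Real.two_pi_pos 0 γ with hN
    set θ := toIcoMod Real.two_pi_pos 0 γ with hθ
    have hθN : γ = θ + N * (2 * Real.pi) := by
      rw [hθ, toIcoMod, zsmul_eq_mul]; ring
    have hθm : θ ∈ Ico (0 : ℝ) (2 * Real.pi) := by
      have := toIcoMod_mem_Ico Real.two_pi_pos 0 γ
      rwa [zero_add] at this
    have hkz : (k : ℤ) ≠ 0 := by exact_mod_cast hk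
    have hj0 := Int.emod_nonneg (N - 1) hkz
    have hjk := Int.emod_lt_of_pos (N - 1) (show (0 : ℤ) < k by omega)
    obtain ⟨j, hj⟩ := Int.eq_ofNat_of_zero_le hj0
    refine ⟨j, by omega, θ, hθm, ?_⟩
    have hNj : (N : ℝ) = j + 1 + k * ((N - 1) / k : ℤ) := by
      have := Int.emod_add_mul_ediv (N - 1) k
      rw [hj] at this
      have h' : N = j + 1 + k * ((N - 1) / k) := by linarith
      exact_mod_cast h'
    rw [rootBranch, cutArg_polarPt hr hθm, norm_polarPt hr.le, ← hs,
      ← polarPt_add_int_mul _ _ ((N - 1) / k)]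
    have : (θ + α + 2 * Real.pi * (j + 1)) / k + ((N - 1) / k : ℤ) * (2 * Real.pi) =
        Complex.arg s := by
      rw [div_add' _ _ _ hk'.ne', div_eq_iff hk'.ne']
      have : Complex.arg s * k = θ + N * (2 * Real.pi) + α := by linarith
      rw [this, hNj]; ring
    rw [this]
    exact (Complex.norm_mul_exp_arg_mul_I s).symm

/-- A branch in terms of an arbitrary determination `w` of `log τ` with imaginary part in
`[0, 2π)`. -/
theorem rootBranch_eq_exp (hρ : 0 < ρ) {τ : ℂ} {w : ℂ} (hw : Complex.exp w = τ)
    (hwm : w.im ∈ Ico (0 : ℝ) (2 * Real.pi)) :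
    rootBranch k ρ α j τ = Complex.exp
      ((w + Real.log ρ + (α + 2 * Real.pi * (j + 1)) * Complex.I) / k) := by
  have hτ : τ ≠ 0 := hw ▸ Complex.exp_ne_zero w
  have hn : ‖τ‖ = Real.exp w.re := by rw [← hw, Complex.norm_exp]
  have hτp : τ = polarPt ‖τ‖ w.im := by
    rw [polarPt, hn, Complex.ofReal_exp, ← Complex.exp_add, Complex.re_add_im, hw]
  have hc : cutArg τ = w.im := by
    conv_lhs => rw [hτp]
    exact cutArg_polarPt (norm_pos_iff.mpr hτ) hwm
  rw [rootBranch, hc, polarPt, Real.rpow_def_of_pos (mul_pos (norm_pos_iff.mpr hτ) hρ),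
    Real.log_mul (norm_pos_iff.mpr hτ).ne' hρ.ne', hn, Real.log_exp, Complex.ofReal_exp,
    ← Complex.exp_add]
  congr 1
  conv_rhs => rw [← Complex.re_add_im w]
  push_cast
  ring

theorem hasDerivAt_exp_branch {f : ℂ → ℂ} {τ : ℂ} (hf : HasDerivAt f τ⁻¹ τ)
    (L : ℂ) : HasDerivAt (fun z => Complex.exp ((f z + L) / k))
      (Complex.exp ((f τ + L) / k) / (k * τ)) τ := by
  refine ((hf.add_const L).div_const (k : ℂ)).cexp.congr_deriv ?_
  simp only [div_eq_mul_inv, mul_inv]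
  ring

/-- Off the cut, a branch is holomorphic. -/
theorem hasDerivAt_rootBranch (hρ : 0 < ρ) {r θ : ℝ} (hr : 0 < r)
    (hθ : θ ∈ Ioo (0 : ℝ) (2 * Real.pi)) :
    HasDerivAt (rootBranch k ρ α j)
      (rootBranch k ρ α j (polarPt r θ) / (k * polarPt r θ)) (polarPt r θ) := by
  set τ := polarPt r θ with hτ
  have hneg : ∀ z : ℂ, -z ∈ Complex.slitPlane →
      Complex.exp (Complex.log (-z) + Real.pi * Complex.I) = z ∧
      (Complex.log (-z) + Real.pi * Complex.I).im ∈ Ico (0 : ℝ) (2 * Real.pi) := by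
    intro z hz
    have h0 := Complex.slitPlane_ne_zero hz
    refine ⟨by rw [Complex.exp_add, Complex.exp_log h0, Complex.exp_pi_mul_I]; ring, ?_⟩
    have h1 : (Complex.log (-z) + Real.pi * Complex.I).im = Complex.arg (-z) + Real.pi := by
      simp [Complex.log_im]
    rw [h1]
    have h2 := Complex.neg_pi_lt_arg (-z)
    have h3 := Complex.arg_le_pi (-z)
    have h4 : Complex.arg (-z) ≠ Real.pi := (Complex.mem_slitPlane_iff_arg.mp hz).1
    have h5 := lt_of_le_of_ne h3 h4
    constructor <;> linarith
  have hslit : -τ ∈ Complex.slitPlane := by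
    have : -τ = r * Complex.exp ((θ - Real.pi : ℝ) * Complex.I) := by
      rw [hτ, polarPt]
      push_cast
      rw [sub_mul, Complex.exp_sub, Complex.exp_pi_mul_I]
      ring
    rw [Complex.mem_slitPlane_iff_arg, this,
      Complex.arg_real_mul _ hr]
    constructor
    · rw [Complex.arg_exp_mul_I, (toIocMod_eq_self Real.two_pi_pos).mpr]
      · linarith [hθ.2]
      · constructor <;> linarith [hθ.1, hθ.2]
    · rw [← this, neg_ne_zero, hτ, ← norm_ne_zero_iff, norm_polarPt hr.le]
      exact hr.ne'
  have hev : ∀ᶠ z in 𝓝 τ, -z ∈ Complex.slitPlane :=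
    continuous_neg.continuousAt.eventually_mem (Complex.isOpen_slitPlane.mem_nhds hslit)
  have hf : HasDerivAt (fun z => Complex.log (-z) + Real.pi * Complex.I) τ⁻¹ τ := by
    have := ((hasDerivAt_neg τ).clog hslit).add_const (Real.pi * Complex.I)
    exact this.congr_deriv (by rw [neg_div_neg_eq, one_div])
  have h := hasDerivAt_exp_branch (k := k) hf (Real.log ρ + (α + 2 * Real.pi * (j + 1)) * Complex.I)
  have heq : ∀ z, -z ∈ Complex.slitPlane → rootBranch k ρ α j z = Complex.exp
      ((Complex.log (-z) + Real.pi * Complex.I +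
        (Real.log ρ + (α + 2 * Real.pi * (j + 1)) * Complex.I)) / k) := fun z hz => by
    rw [rootBranch_eq_exp hρ (hneg z hz).1 (hneg z hz).2, ← add_assoc]
  rw [heq τ hslit]
  exact h.congr_of_eventuallyEq (hev.mono heq)

/-- Along the closed upper half-plane, a branch is differentiable up to the cut. -/
theorem hasDerivWithinAt_rootBranch (hρ : 0 < ρ) {r : ℝ} (hr : 0 < r) :
    HasDerivWithinAt (rootBranch k ρ α j)
      (rootBranch k ρ α j (polarPt r 0) / (k * polarPt r 0)) {z : ℂ | 0 ≤ z.im}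
      (polarPt r 0) := by
  rw [polarPt_zero_right]
  have hslit : (r : ℂ) ∈ Complex.slitPlane := Complex.ofReal_mem_slitPlane.mpr hr
  have hf : HasDerivAt Complex.log (r : ℂ)⁻¹ r := Complex.hasDerivAt_log hslit
  have h := hasDerivAt_exp_branch (k := k) hf (Real.log ρ + (α + 2 * Real.pi * (j + 1)) * Complex.I)
  have heq : ∀ z : ℂ, z ≠ 0 → 0 ≤ z.im → rootBranch k ρ α j z = Complex.exp
      ((Complex.log z + (Real.log ρ + (α + 2 * Real.pi * (j + 1)) * Complex.I)) / k) := by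
    intro z hz hzi
    rw [rootBranch_eq_exp hρ (Complex.exp_log hz), ← add_assoc]
    rw [Complex.log_im]
    exact ⟨Complex.arg_nonneg_iff.mpr hzi, by linarith [Complex.arg_le_pi z, Real.pi_pos]⟩
  have hr0 : (r : ℂ) ≠ 0 := Complex.ofReal_ne_zero.mpr hr.ne'
  rw [heq r hr0 (by simp)]
  refine h.hasDerivWithinAt.congr_of_eventuallyEq ?_ (heq r hr0 (by simp))
  filter_upwards [self_mem_nhdsWithin, mem_nhdsWithin_of_mem_nhds (isOpen_ne.mem_nhds hr0)]
    with z hz hz0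
  exact heq z hz0 hz

theorem tendsto_mul_rpow_inv_atTop (hk : k ≠ 0) (hρ : 0 < ρ) :
    Tendsto (fun t : ℝ => (t * ρ) ^ (1 / (k : ℝ))) atTop atTop :=
  (tendsto_rpow_atTop (by positivity)).comp (tendsto_id.atTop_mul_const hρ)

/-- Going around the origin once permutes the branches cyclically. -/
theorem tendsto_rootBranch_two_pi {κ : ℕ} (j : Fin (κ + 1)) {r : ℝ} (hr : 0 < r) :
    Tendsto (fun θ : ℝ => rootBranch (κ + 1) ρ α j (polarPt r θ)) (𝓝[<] (2 * Real.pi))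
      (𝓝 (rootBranch (κ + 1) ρ α (j + 1 : Fin (κ + 1)) r)) := by
  have hk' : ((κ + 1 : ℕ) : ℝ) ≠ 0 := Nat.cast_ne_zero.mpr (Nat.succ_ne_zero κ)
  set F : ℝ → ℂ := fun θ => polarPt ((r * ρ) ^ (1 / ((κ + 1 : ℕ) : ℝ)))
    ((θ + α + 2 * Real.pi * ((j : ℕ) + 1)) / (κ + 1 : ℕ)) with hF
  have hcont : Continuous F := (continuous_polarPt _).comp (by fun_prop)
  have hlim : F (2 * Real.pi) = rootBranch (κ + 1) ρ α (j + 1 : Fin (κ + 1)) r := by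
    have h0 : cutArg (r : ℂ) = 0 := by
      rw [← polarPt_zero_right, cutArg_polarPt hr ⟨le_rfl, Real.two_pi_pos⟩]
    rw [rootBranch, h0, Complex.norm_real, Real.norm_of_nonneg hr.le]
    simp only [hF]
    rcases eq_or_ne j (Fin.last κ) with rfl | hj
    · rw [Fin.last_add_one, ← polarPt_add_int_mul _ ((0 + α + _) / _) 1]
      congr 1
      simp only [Fin.val_last, Fin.val_zero]
      field_simp
      push_cast
      ring
    · rw [Fin.val_add_one_of_lt (Fin.lt_last_iff_ne_last.mpr hj)]
      congr 1
      push_cast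
      ring
  have ht : Tendsto F (𝓝[<] (2 * Real.pi)) (𝓝 (F (2 * Real.pi))) :=
    hcont.continuousAt.tendsto.mono_left nhdsWithin_le_nhds
  rw [hlim] at ht
  refine ht.congr' ?_
  filter_upwards [Ioo_mem_nhdsLT Real.two_pi_pos] with θ hθ
  rw [rootBranch, cutArg_polarPt hr ⟨hθ.1.le, hθ.2⟩, norm_polarPt hr.le]

end rootBranch

/-! ### Images of circles -/

theorem polarPt_image_Icc {t : ℝ} (ht : 0 < t) :
    polarPt t '' Icc (0 : ℝ) (2 * Real.pi) = Metric.sphere (0 : ℂ) t := by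
  ext s
  simp only [mem_image, mem_sphere_zero_iff_norm]
  constructor
  · rintro ⟨θ, _, rfl⟩
    exact norm_polarPt ht.le θ
  · intro hs
    exact ⟨cutArg s, Ico_subset_Icc_self (cutArg_mem s), by rw [← hs, polarPt_cutArg]⟩

theorem isSimpleClosedCurve_comp_polarPt {ψ : ℂ → ℂ} {t : ℝ} (ht : 0 < t)
    (hc : ContinuousOn ψ (Metric.sphere 0 t)) (hi : InjOn ψ (Metric.sphere 0 t)) :
    IsSimpleClosedCurve (fun θ => ψ (polarPt t θ)) := by
  have hm : ∀ θ, polarPt t θ ∈ Metric.sphere (0 : ℂ) t := fun θ => by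
    rw [mem_sphere_zero_iff_norm, norm_polarPt ht.le]
  refine ⟨(hc.comp_continuous (continuous_polarPt t) hm).continuousOn, ?_, ?_⟩
  · have := polarPt_add_int_mul t 0 1
    simp only [zero_add, Int.cast_one, one_mul] at this
    simp only [this]
  · intro θ hθ φ hφ h
    have h' := hi (hm θ) (hm φ) h
    rw [← cutArg_polarPt ht hθ, h', cutArg_polarPt ht hφ]

theorem curveTrace_comp_polarPt (ψ : ℂ → ℂ) {t : ℝ} (ht : 0 < t) :
    curveTrace (fun θ => ψ (polarPt t θ)) = ψ '' Metric.sphere 0 t := by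
  rw [← polarPt_image_Icc ht, image_image, curveTrace]

/-! ### The polynomial `p_{uv}` -/

section puv

variable {n : ℕ} (A : Matrix (Fin n) (Fin n) ℂ) (u v : Fin n → ℂ)

theorem starForm_sub (M N : Matrix (Fin n) (Fin n) ℂ) :
    starForm v (M - N) u = starForm v M u - starForm v N u := by
  simp [starForm, sub_mulVec]

theorem starForm_smul (c : ℂ) (M : Matrix (Fin n) (Fin n) ℂ) :
    starForm v (c • M) u = c * starForm v M u := by
  simp [starForm, smul_mulVec]

theorem starForm_sum {ι : Type*} (s : Finset ι) (M : ι → Matrix (Fin n) (Fin n) ℂ) :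
    starForm v (∑ i ∈ s, M i) u = ∑ i ∈ s, starForm v (M i) u := by
  simp [starForm, sum_mulVec, dotProduct_sum]

theorem starForm_mulVec (M N : Matrix (Fin n) (Fin n) ℂ) :
    starForm v M (N *ᵥ u) = starForm v (M * N) u := by
  simp [starForm, mulVec_mulVec]

variable {A} in
theorem isUnit_smul_one_sub {z : ℂ} (hz : z ∉ spectrum ℂ A) :
    IsUnit (z • (1 : Matrix (Fin n) (Fin n) ℂ) - A) := by
  have := spectrum.notMem_iff.mp hz
  rwa [Algebra.algebraMap_eq_smul_one] at this

variable {A} in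
theorem mul_resolventAt {z : ℂ} (hz : z ∉ spectrum ℂ A) :
    (z • (1 : Matrix (Fin n) (Fin n) ℂ) - A) * resolventAt A z = 1 :=
  mul_nonsing_inv _ ((isUnit_iff_isUnit_det _).mp (isUnit_smul_one_sub hz))

variable {A} in
theorem resolventAt_mul {z : ℂ} (hz : z ∉ spectrum ℂ A) :
    resolventAt A z * (z • (1 : Matrix (Fin n) (Fin n) ℂ) - A) = 1 :=
  nonsing_inv_mul _ ((isUnit_iff_isUnit_det _).mp (isUnit_smul_one_sub hz))

/-- The coefficients of `p_{uv}`, read off from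
`m(z) - m(A) = (z - A) ∑ₖ mₖ ∑_{i < k} zⁱ A ^ (k - 1 - i)`. -/
theorem puv_eq_sum : puv A u v = ∑ k ∈ Finset.range ((minpoly ℂ A).natDegree + 1),
    ∑ i ∈ Finset.range k,
      C ((minpoly ℂ A).coeff k * starForm v (A ^ (k - 1 - i)) u) * X ^ i := by
  refine (puv_unique A u v _ fun z hz => ?_).symm
  set m := minpoly ℂ A with hm
  set q : Matrix (Fin n) (Fin n) ℂ := ∑ k ∈ Finset.range (m.natDegree + 1),
    m.coeff k • ∑ i ∈ Finset.range k, (z • (1 : Matrix (Fin n) (Fin n) ℂ)) ^ i * A ^ (k - 1 - i)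
    with hq
  have hmul : (z • (1 : Matrix (Fin n) (Fin n) ℂ) - A) * q = m.eval z • 1 := by
    have hA : aeval A m = 0 := minpoly.aeval ℂ A
    rw [aeval_eq_sum_range] at hA
    rw [hq, Finset.mul_sum]
    have hc : Commute (z • (1 : Matrix (Fin n) (Fin n) ℂ)) A := (Commute.one_left A).smul_left z
    calc _ = ∑ k ∈ Finset.range (m.natDegree + 1),
          m.coeff k • ((z • (1 : Matrix (Fin n) (Fin n) ℂ)) ^ k - A ^ k) :=
          Finset.sum_congr rfl fun k _ => by rw [mul_smul_comm, hc.mul_geom_sum₂]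
      _ = _ := by
          simp only [smul_sub, Finset.sum_sub_distrib, hA, sub_zero, _root_.smul_pow, one_pow]
          rw [eval_eq_sum_range, Finset.sum_smul]
          simp [smul_smul]
  have hq2 : q = m.eval z • resolventAt A z := by
    have := congrArg (fun M => resolventAt A z * M) hmul
    simpa only [← mul_assoc, resolventAt_mul hz, one_mul, mul_smul_comm, mul_one] using this
  rw [← starForm_smul, ← hq2, hq]
  simp only [starForm_sum, starForm_smul, _root_.smul_pow, one_pow, smul_mul_assoc, one_mul,
    Finset.mul_sum, eval_finsetSum, eval_mul, eval_C, eval_pow, eval_X]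
  exact Finset.sum_congr rfl fun k _ => Finset.sum_congr rfl fun i _ => by ring

theorem coeff_puv (i : ℕ) : (puv A u v).coeff i =
    ∑ k ∈ Finset.range ((minpoly ℂ A).natDegree + 1),
      if i < k then (minpoly ℂ A).coeff k * starForm v (A ^ (k - 1 - i)) u else 0 := by
  rw [puv_eq_sum, finsetSum_coeff]
  refine Finset.sum_congr rfl fun k _ => ?_
  simp only [finsetSum_coeff, coeff_C_mul, coeff_X_pow, mul_ite, mul_one, mul_zero,
    Finset.sum_ite_eq, Finset.mem_range]

variable {A u v} in
theorem natDegree_puv_and_leadingCoeff {κ : ℕ} (hκ : κ < (minpoly ℂ A).natDegree)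
    (hzero : ∀ j < κ, starForm v (A ^ j) u = 0) (hne : starForm v (A ^ κ) u ≠ 0) :
    (puv A u v).natDegree = (minpoly ℂ A).natDegree - κ - 1 ∧
      (puv A u v).leadingCoeff = starForm v (A ^ κ) u := by
  have hmonic : (minpoly ℂ A).Monic := minpoly.monic (Matrix.isIntegral A)
  set l := (minpoly ℂ A).natDegree with hl
  have hcoeff : (puv A u v).coeff (l - κ - 1) = starForm v (A ^ κ) u := by
    rw [coeff_puv, Finset.sum_range_succ, if_pos (by omega), Finset.sum_eq_zero, zero_add,
      ← hl, hmonic.coeff_natDegree, one_mul]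
    · congr 2; omega
    · intro k hk
      rw [Finset.mem_range] at hk
      split_ifs with h
      · rw [hzero _ (by omega), mul_zero]
      · rfl
  have hle : (puv A u v).natDegree ≤ l - κ - 1 := by
    rw [natDegree_le_iff_coeff_eq_zero]
    intro i hi
    rw [coeff_puv]
    refine Finset.sum_eq_zero fun k hk => ?_
    rw [Finset.mem_range] at hk
    split_ifs with h
    · rw [hzero _ (by omega), mul_zero]
    · rfl
  have heq : (puv A u v).natDegree = l - κ - 1 :=
    natDegree_eq_of_le_of_coeff_ne_zero hle (hcoeff ▸ hne)
  exact ⟨heq, by rw [leadingCoeff, heq, hcoeff]⟩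

/-- The determinant formula `det (z - B(τ)) = (det (z - A) / m(z)) (m(z) - τ p_{uv}(z))`. -/
theorem charpoly_rankOnePert (τ : ℂ) : (rankOnePert A u v τ).charpoly =
    (A.charpoly /ₘ minpoly ℂ A) * (minpoly ℂ A - C τ * puv A u v) := by
  have hmonic : (minpoly ℂ A).Monic := minpoly.monic (Matrix.isIntegral A)
  have hfac : minpoly ℂ A * (A.charpoly /ₘ minpoly ℂ A) = A.charpoly := by
    have h := modByMonic_add_div A.charpoly (minpoly ℂ A)
    rwa [(modByMonic_eq_zero_iff_dvd hmonic).mpr (Matrix.minpoly_dvd_charpoly A), zero_add] at h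
  have hfin : (spectrum ℂ A).Finite := Matrix.finite_spectrum A
  refine Polynomial.eq_of_infinite_eval_eq _ _ (hfin.infinite_compl.mono fun z hz => ?_)
  simp only [Set.mem_ofPred_eq]
  have hm : z • (1 : Matrix (Fin n) (Fin n) ℂ) - rankOnePert A u v τ =
      (z • (1 : Matrix (Fin n) (Fin n) ℂ) - A) +
        replicateCol Unit ((-τ) • u) * replicateRow Unit (star v) := by
    rw [← vecMulVec_eq, rankOnePert, smul_vecMulVec, neg_smul]
    abel
  have hdet := det_add_replicateCol_mul_replicateRow (ι := Unit)
    ((isUnit_iff_isUnit_det _).mp (isUnit_smul_one_sub hz)) ((-τ) • u) (star v)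
  have hev : ∀ M : Matrix (Fin n) (Fin n) ℂ, M.charpoly.eval z =
      (z • (1 : Matrix (Fin n) (Fin n) ℂ) - M).det := fun M => by
    rw [eval_charpoly, scalar_apply, ← smul_one_eq_diagonal]
  have hone : (replicateRow Unit (star v) * (z • (1 : Matrix (Fin n) (Fin n) ℂ) - A)⁻¹ *
      replicateCol Unit ((-τ) • u)).det = -τ * starForm v (resolventAt A z) u := by
    rw [det_unique, Matrix.mul_assoc, ← replicateCol_mulVec, replicateRow_mul_replicateCol_apply,
      mulVec_smul, dotProduct_smul, smul_eq_mul, starForm, resolventAt]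
  rw [eval_mul, eval_sub, eval_mul, eval_C, puv_spec A u v z hz, hev, hm, hdet, ← hev]
  conv_lhs => rw [← hfac, eval_mul]
  rw [det_unique] at hone ⊢
  rw [Matrix.add_apply, Matrix.one_apply_eq, hone]
  ring

/-- The resolvent identity. -/
theorem resolventAt_sub {z ζ : ℂ} (hz : z ∉ spectrum ℂ A) (hζ : ζ ∉ spectrum ℂ A) :
    resolventAt A z - resolventAt A ζ = (ζ - z) • (resolventAt A z * resolventAt A ζ) := by
  calc _ = resolventAt A z * ((ζ • (1 : Matrix (Fin n) (Fin n) ℂ) - A) -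
          (z • (1 : Matrix (Fin n) (Fin n) ℂ) - A)) * resolventAt A ζ := by
        rw [mul_sub, sub_mul, mul_assoc, mul_resolventAt hζ, resolventAt_mul hz, mul_one, one_mul]
    _ = _ := by
        rw [sub_sub_sub_cancel_right, ← sub_smul, mul_smul_comm, mul_one, smul_mul_assoc]

theorem eval_minpoly_ne_zero {ζ : ℂ} (hζ : ζ ∉ spectrum ℂ A) : (minpoly ℂ A).eval ζ ≠ 0 :=
  fun h => hζ (mem_spectrum_iff_isRoot_charpoly.mpr
    (IsRoot.dvd h (Matrix.minpoly_dvd_charpoly A)))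

/-- Dividing `p_{uv}` by one of its linear factors amounts to replacing `u` by
`-(ζ - A)⁻¹ u`. -/
theorem puv_eq_mul_of_isRoot {ζ : ℂ} (hζ : ζ ∉ spectrum ℂ A) (h : (puv A u v).IsRoot ζ) :
    puv A u v = -(X - C ζ) * puv A (resolventAt A ζ *ᵥ u) v := by
  have hfin : (spectrum ℂ A).Finite := Matrix.finite_spectrum A
  refine Polynomial.eq_of_infinite_eval_eq _ _ (hfin.infinite_compl.mono fun z hz => ?_)
  simp only [Set.mem_ofPred_eq]
  have h0 : starForm v (resolventAt A ζ) u = 0 := by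
    have h' := puv_spec A u v ζ hζ
    rw [h.eq_zero] at h'
    exact (mul_eq_zero.mp h'.symm).resolve_left (eval_minpoly_ne_zero A hζ)
  have h1 := congrArg (fun M => starForm v M u) (resolventAt_sub A hz hζ)
  simp only [starForm_sub, starForm_smul, h0, sub_zero] at h1
  rw [eval_mul, puv_spec A (resolventAt A ζ *ᵥ u) v z hz, puv_spec A u v z hz, starForm_mulVec, h1]
  simp only [eval_neg, eval_sub, eval_X, eval_C]
  ring

/-- For `j` at most the multiplicity of `ζ`, removing `j` factors `z - ζ` gives
`p_{uv}(z) = (-1)ʲ (z - ζ)ʲ m(z) v* (z - A)⁻¹ (ζ - A)⁻ʲ u`. -/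
theorem puv_eq_pow_mul {ζ : ℂ} (hζ : ζ ∉ spectrum ℂ A) (j : ℕ)
    (hj : j ≤ (puv A u v).rootMultiplicity ζ) :
    puv A u v = (-(X - C ζ)) ^ j * puv A ((resolventAt A ζ ^ j) *ᵥ u) v := by
  induction j with
  | zero => simp
  | succ j ih =>
    have ih' := ih (by omega)
    have hroot : (puv A ((resolventAt A ζ ^ j) *ᵥ u) v).IsRoot ζ := by
      by_contra hc
      have h0 : puv A u v ≠ 0 := fun h => by simp [h] at hj
      have hd := (le_rootMultiplicity_iff h0).mp hj
      rw [ih', neg_pow, pow_succ, mul_comm ((-1) ^ j), mul_assoc] at hd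
      have hd' := (mul_dvd_mul_iff_left (pow_ne_zero j (X_sub_C_ne_zero ζ))).mp hd
      have hu : IsUnit ((-1 : ℂ[X]) ^ j) := (isUnit_neg_one).pow j
      rw [hu.dvd_mul_left] at hd'
      exact hc (dvd_iff_isRoot.mp hd')
    rw [ih', puv_eq_mul_of_isRoot A _ v hζ hroot, pow_succ, pow_succ', mulVec_mulVec, mul_assoc]

/-- The leading coefficient of `p_{uv} / m` at a root which is not an eigenvalue of `A`. -/
theorem norm_div_eq_rhoAt {ζ : ℂ} (hζ : ζ ∉ spectrum ℂ A) :
    ‖(puv A u v /ₘ (X - C ζ) ^ (puv A u v).rootMultiplicity ζ).eval ζ /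
      (minpoly ℂ A).eval ζ‖ = rhoAt A u v ζ := by
  have hm := eval_minpoly_ne_zero A hζ
  have h := puv_eq_pow_mul A u v hζ _ le_rfl
  set k := (puv A u v).rootMultiplicity ζ with hk
  have h2 := pow_mul_divByMonic_rootMultiplicity_eq (puv A u v) ζ
  rw [← hk] at h2
  rw [neg_pow, mul_comm ((-1) ^ k), mul_assoc] at h
  have h3 := mul_left_cancel₀ (pow_ne_zero k (X_sub_C_ne_zero ζ)) (h2.trans h)
  rw [h3, eval_mul, puv_spec A _ v ζ hζ, starForm_mulVec, ← pow_succ', rhoAt, ← hk]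
  rw [mul_left_comm, mul_div_cancel_left₀ _ hm]
  simp

end puv

/-! ### Branches of the solutions of `a z = τ b z` for large `τ` -/

theorem exists_pos_forall_of_eventually_atTop {P : ℝ → Prop} (h : ∀ᶠ r in atTop, P r) :
    ∃ R : ℝ, 0 < R ∧ ∀ r > R, P r := by
  obtain ⟨R, hR⟩ := eventually_atTop.mp h
  exact ⟨max R 1, lt_max_of_lt_right one_pos, fun r hr => hR r ((le_max_left _ _).trans hr.le)⟩

/-- The large solutions `lam j` of `a z = τ b z`, where `deg a = deg b + κ + 1`, and the curve `Γ r`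
which they trace out over the circle of radius `r`. -/
theorem exists_large_branches {a b : ℂ[X]} (hb : b ≠ 0) {κ : ℕ}
    (hdeg : a.natDegree = b.natDegree + (κ + 1)) {w : ℂ} {ρ α : ℝ} (hρ : 0 < ρ)
    (hlead : b.leadingCoeff / a.leadingCoeff = w) (hw : w = polarPt ρ α) (M : ℝ) :
    ∃ (R K : ℝ) (lam : Fin (κ + 1) → ℂ → ℂ) (Γ : ℝ → ℝ → ℂ), 0 < R ∧
      (∀ τ : ℂ, R < ‖τ‖ → Function.Injective fun j => lam j τ) ∧
      (∀ τ : ℂ, R < ‖τ‖ → ∀ j, M < ‖lam j τ‖ ∧ a.eval (lam j τ) = τ * b.eval (lam j τ)) ∧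
      (∀ j : Fin (κ + 1), ∀ r > R, ∀ θ ∈ Ico (0 : ℝ) (2 * Real.pi),
        ‖lam j (polarPt r θ) - polarPt ((r * ρ) ^ (1 / ((κ : ℝ) + 1)))
          (1 / ((κ : ℝ) + 1) * (θ + α) + 2 * ((j : ℝ) + 1) / ((κ : ℝ) + 1) * Real.pi)‖ ≤ K) ∧
      (∀ j : Fin (κ + 1), ∀ r > R, ∀ θ ∈ Ico (0 : ℝ) (2 * Real.pi), ∃ D : ℂ,
        (0 < θ → HasDerivAt (lam j) D (polarPt r θ)) ∧
        (θ = 0 → HasDerivWithinAt (lam j) D {z : ℂ | 0 ≤ z.im} (polarPt r θ)) ∧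
        ‖D - w / (((κ : ℂ) + 1) * lam j (polarPt r θ) ^ κ)‖ ≤
          K * (‖lam j (polarPt r θ)‖ ^ (κ + 1))⁻¹) ∧
      (∀ r > R, IsSimpleClosedCurve (Γ r) ∧
        curveTrace (Γ r) =
          {z | ∃ j, ∃ θ ∈ Ico (0 : ℝ) (2 * Real.pi), z = lam j (polarPt r θ)} ∧
        ∀ θ ∈ Icc (0 : ℝ) (2 * Real.pi),
          ‖Γ r θ - polarPt ((r * ρ) ^ (1 / ((κ : ℝ) + 1))) θ‖ ≤ K) ∧
      (∀ j : Fin (κ + 1), ∀ r > R,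
        Tendsto (fun θ : ℝ => lam j (polarPt r θ)) (𝓝[<] (2 * Real.pi))
          (𝓝 (lam (j + 1) (r : ℂ)))) := by
  obtain ⟨ψ, ψ', T, C, hT, hC, hder, hinj, hM, heq, hclose, hder'⟩ :=
    exists_chart_at_infinity hb hdeg M
  rw [hlead] at heq
  have hk : κ + 1 ≠ 0 := Nat.succ_ne_zero κ
  have ha : a ≠ 0 := by rintro rfl; simp at hdeg
  have hcast : ((κ + 1 : ℕ) : ℝ) = (κ : ℝ) + 1 := by push_cast; rfl
  have hκC : (κ : ℂ) + 1 ≠ 0 := by exact_mod_cast hk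
  have hκR : (0 : ℝ) < (κ : ℝ) + 1 := by positivity
  have hw0 : w ≠ 0 := by
    rw [hw, ← norm_ne_zero_iff, norm_polarPt hρ.le]; exact hρ.ne'
  have hwn : ‖w‖ = ρ := by rw [hw, norm_polarPt hρ.le]
  obtain ⟨R, hR, hRT⟩ := exists_pos_forall_of_eventually_atTop
    ((tendsto_mul_rpow_inv_atTop hk hρ).eventually_gt_atTop T)
  set s : ℕ → ℂ → ℂ := fun j => rootBranch (κ + 1) ρ α j with hs
  have hsn : ∀ j τ, ‖s j τ‖ = (‖τ‖ * ρ) ^ (1 / ((κ + 1 : ℕ) : ℝ)) := fun j τ =>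
    norm_rootBranch hρ.le τ
  have hsT : ∀ j τ, R < ‖τ‖ → T < ‖s j τ‖ := fun j τ hτ => by rw [hsn]; exact hRT _ hτ
  have hpn : ∀ r > R, ∀ θ, R < ‖polarPt r θ‖ := fun r hr θ => by
    rwa [norm_polarPt (hR.trans hr).le]
  have hsphere : ∀ r > R, Metric.sphere (0 : ℂ) ((r * ρ) ^ (1 / ((κ + 1 : ℕ) : ℝ))) ⊆
      {s | T < ‖s‖} := fun r hr z hz => by
    rw [mem_sphere_zero_iff_norm] at hz
    rw [mem_ofPred_eq, hz]; exact hRT r hr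
  have htpos : ∀ r > R, 0 < (r * ρ) ^ (1 / ((κ + 1 : ℕ) : ℝ)) := fun r hr => hT.trans (hRT r hr)
  -- the derivative of a branch, in the form that is compared with `w / ((κ + 1) λ ^ κ)`
  have hD : ∀ (j : ℕ) (τ : ℂ), R < ‖τ‖ → ‖ψ' (s j τ) * (s j τ / ((κ + 1 : ℕ) * τ)) -
      w / (((κ : ℂ) + 1) * ψ (s j τ) ^ κ)‖ ≤ C * (1 + ρ) * (‖ψ (s j τ)‖ ^ (κ + 1))⁻¹ := by
    intro j τ hτ
    have hτ0 : τ ≠ 0 := norm_pos_iff.mp (hR.trans hτ)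
    have hs0 : s j τ ≠ 0 := norm_pos_iff.mp (hT.trans (hsT j τ hτ))
    have hpow : s j τ ^ (κ + 1) = w * τ := by rw [hw]; exact rootBranch_pow hk hρ.le τ
    have hquot : s j τ / ((κ + 1 : ℕ) * τ) = w / (((κ : ℂ) + 1) * s j τ ^ κ) := by
      rw [div_eq_div_iff (mul_ne_zero (by exact_mod_cast hk) hτ0)
        (mul_ne_zero hκC (pow_ne_zero _ hs0))]
      calc _ = ((κ : ℂ) + 1) * s j τ ^ (κ + 1) := by ring
        _ = _ := by rw [hpow]; push_cast; ring
    have : ψ' (s j τ) * (s j τ / ((κ + 1 : ℕ) * τ)) - w / (((κ : ℂ) + 1) * ψ (s j τ) ^ κ) =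
        w / ((κ : ℂ) + 1) * (ψ' (s j τ) / s j τ ^ κ - 1 / ψ (s j τ) ^ κ) := by
      rw [hquot, mul_sub]
      congr 1
      · rw [div_mul_div_comm, mul_div_assoc', mul_comm w]
      · rw [div_mul_div_comm, mul_one]
    rw [this, norm_mul]
    have h1 : ‖w / ((κ : ℂ) + 1)‖ ≤ 1 + ρ := by
      have h2 : ‖((κ : ℂ) + 1)‖ = (κ : ℝ) + 1 := by
        rw [← hcast, ← Complex.norm_natCast]; push_cast; rfl
      rw [norm_div, hwn, h2, div_le_iff₀ hκR]
      nlinarith [Nat.cast_nonneg (α := ℝ) κ]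
    calc _ ≤ (1 + ρ) * (C * (‖ψ (s j τ)‖ ^ (κ + 1))⁻¹) := by
          gcongr
          exact hder' _ (hsT j τ hτ)
      _ = _ := by ring
  have hCK : C ≤ C * (1 + ρ) := by nlinarith
  refine ⟨R, C * (1 + ρ), fun j τ => ψ (s j τ),
    fun r θ => ψ (polarPt ((r * ρ) ^ (1 / ((κ + 1 : ℕ) : ℝ))) θ), hR, fun τ hτ i j hij => ?_,
    fun τ hτ j => ⟨hM _ (hsT j τ hτ), ?_⟩, fun j r hr θ hθ => ?_, fun j r hr θ hθ => ?_,
    fun r hr => ⟨?_, ?_, fun θ _ => ?_⟩, fun j r hr => ?_⟩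
  · exact Fin.ext (rootBranch_injOn hρ (norm_pos_iff.mp (hR.trans hτ)) i.isLt j.isLt
      (hinj (hsT i τ hτ) (hsT j τ hτ) hij))
  · have h := heq _ (hsT j τ hτ)
    have hpow : s j τ ^ (κ + 1) = w * τ := by rw [hw]; exact rootBranch_pow hk hρ.le τ
    rw [hpow] at h
    refine mul_left_cancel₀ hw0 ?_
    rw [← h]; ring
  · refine le_trans ?_ hCK
    have hph : polarPt ((r * ρ) ^ (1 / ((κ : ℝ) + 1)))
        (1 / ((κ : ℝ) + 1) * (θ + α) + 2 * ((j : ℝ) + 1) / ((κ : ℝ) + 1) * Real.pi) =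
        s j (polarPt r θ) := by
      simp only [hs]
      rw [rootBranch, norm_polarPt (hR.trans hr).le, cutArg_polarPt (hR.trans hr) hθ, hcast]
      congr 1
      field_simp
    rw [hph]
    exact hclose _ (hsT j _ (hpn r hr θ))
  · refine ⟨_, fun hθ0 => ?_, fun hθ0 => ?_, hD j _ (hpn r hr θ)⟩
    · exact (hder _ (hsT j _ (hpn r hr θ))).comp _
        (hasDerivAt_rootBranch hρ (hR.trans hr) ⟨hθ0, hθ.2⟩)
    · subst hθ0
      exact (hder _ (hsT j _ (hpn r hr 0))).comp_hasDerivWithinAt _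
        (hasDerivWithinAt_rootBranch hρ (hR.trans hr))
  · exact isSimpleClosedCurve_comp_polarPt (htpos r hr)
      (fun z hz => (hder z (hsphere r hr hz)).continuousAt.continuousWithinAt)
      (hinj.mono (hsphere r hr))
  · rw [curveTrace_comp_polarPt ψ (htpos r hr),
      ← rootBranch_image (α := α) hk hρ (hR.trans hr)]
    ext z
    constructor
    · rintro ⟨_, ⟨j, hj, θ, hθ, rfl⟩, rfl⟩
      exact ⟨⟨j, hj⟩, θ, hθ, rfl⟩
    · rintro ⟨j, θ, hθ, rfl⟩
      exact ⟨_, ⟨j, j.isLt, θ, hθ, rfl⟩, rfl⟩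
  · rw [hcast]
    refine le_trans (hclose _ ?_) hCK
    have := htpos r hr
    have h2 := hRT r hr
    rw [hcast] at this h2
    rw [norm_polarPt this.le]
    exact h2
  · have hT' : T < ‖s (j + 1 : Fin (κ + 1)) (r : ℂ)‖ :=
      hsT _ _ (by rw [Complex.norm_real, Real.norm_of_nonneg (hR.trans hr).le]; exact hr)
    exact (hder _ hT').continuousAt.tendsto.comp (tendsto_rootBranch_two_pi j (hR.trans hr))

/-- The solutions `mu i` of `a z = τ b z` near a root `ζ` of `b` of multiplicity `k`, and the curve
`Γ r` which they trace out over the circle of radius `r`. -/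
theorem exists_bounded_branches {a b : ℂ[X]} {ζ : ℂ} (ha : a.eval ζ ≠ 0) (hb : b ≠ 0)
    (hζ : b.IsRoot ζ) {U : Set ℂ} (hU : U ∈ 𝓝 ζ) {k : ℕ} (hk : k = b.rootMultiplicity ζ) {ρ : ℝ}
    (hρ : ρ = ‖(b /ₘ (X - C ζ) ^ k).eval ζ / a.eval ζ‖) :
    ∃ (R K : ℝ) (mu : Fin k → ℂ → ℂ) (Γ : ℝ → ℝ → ℂ), 0 < ρ ∧ 0 < R ∧
      (∀ τ : ℂ, R < ‖τ‖ → Function.Injective fun i => mu i τ) ∧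
      (∀ τ : ℂ, R < ‖τ‖ → ∀ i, mu i τ ∈ U ∧ a.eval (mu i τ) = τ * b.eval (mu i τ)) ∧
      (∀ i, Tendsto (mu i) (Bornology.cobounded ℂ) (𝓝 ζ)) ∧
      ∀ r > R, IsSimpleClosedCurve (Γ r) ∧
        curveTrace (Γ r) =
          {z | ∃ i, ∃ θ ∈ Ico (0 : ℝ) (2 * Real.pi), z = mu i (polarPt r θ)} ∧
        ∀ θ ∈ Icc (0 : ℝ) (2 * Real.pi),
          ‖Γ r θ - (ζ + polarPt (r ^ (-1 / (k : ℝ)) * ρ ^ (-1 / (k : ℝ))) θ)‖ ≤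
            K * r ^ (-2 / (k : ℝ)) := by
  obtain ⟨c, hc, hc0, ψ, δ, C, hδ, hC, hψ0, hcont, hinj, hmaps, heq, hclose⟩ :=
    exists_chart_at_root ha hb hζ hU
  rw [← hk] at hc heq
  have hk0 : k ≠ 0 := by rw [hk]; exact ((rootMultiplicity_pos hb).mpr hζ).ne'
  have hkR : (0 : ℝ) < k := by exact_mod_cast Nat.pos_of_ne_zero hk0
  rw [← hc] at hρ
  have hρ0 : 0 < ρ := hρ ▸ norm_pos_iff.mpr hc0
  set α := Complex.arg c with hα
  have hcp : polarPt ρ α = c := by rw [hρ]; exact Complex.norm_mul_exp_arg_mul_I c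
  obtain ⟨R, hR, hRT⟩ := exists_pos_forall_of_eventually_atTop
    ((tendsto_mul_rpow_inv_atTop hk0 hρ0).eventually_gt_atTop δ⁻¹)
  -- the local coordinate `x` satisfies `c τ x ^ k = 1`
  set x : ℕ → ℂ → ℂ := fun j τ => (rootBranch k ρ α j τ)⁻¹ with hx
  have hxn : ∀ j τ, ‖x j τ‖ = ((‖τ‖ * ρ) ^ (1 / (k : ℝ)))⁻¹ := fun j τ => by
    simp only [hx]; rw [norm_inv, norm_rootBranch hρ0.le]
  have htpos : ∀ r > R, 0 < ((r * ρ) ^ (1 / (k : ℝ)))⁻¹ := fun r hr =>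
    inv_pos.mpr ((inv_pos.mpr hδ).trans (hRT r hr))
  have htδ : ∀ r > R, ((r * ρ) ^ (1 / (k : ℝ)))⁻¹ < δ := fun r hr =>
    inv_lt_of_inv_lt₀ hδ (hRT r hr)
  have hxδ : ∀ j τ, R < ‖τ‖ → x j τ ∈ Metric.ball (0 : ℂ) δ := fun j τ hτ => by
    rw [mem_ball_zero_iff, hxn]; exact htδ _ hτ
  have hsphere : ∀ r > R, Metric.sphere (0 : ℂ) ((r * ρ) ^ (1 / (k : ℝ)))⁻¹ ⊆
      Metric.ball (0 : ℂ) δ := fun r hr => Metric.sphere_subset_ball (htδ r hr)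
  refine ⟨R, C * ρ ^ (-2 / (k : ℝ)), fun i τ => ψ (x i τ),
    fun r θ => ψ (polarPt ((r * ρ) ^ (1 / (k : ℝ)))⁻¹ θ), hρ0, hR, fun τ hτ i j hij => ?_,
    fun τ hτ i => ⟨hmaps (hxδ i τ hτ), ?_⟩, fun i => ?_,
    fun r hr => ⟨?_, ?_, fun θ _ => ?_⟩⟩
  · exact Fin.ext (rootBranch_injOn hρ0 (norm_pos_iff.mp (hR.trans hτ)) i.isLt j.isLt
      (inv_injective (hinj (hxδ i τ hτ) (hxδ j τ hτ) hij)))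
  · have hτ0 : τ ≠ 0 := norm_pos_iff.mp (hR.trans hτ)
    rw [heq _ (hxδ i τ hτ)]
    have hpow : x i τ ^ k = (c * τ)⁻¹ := by
      simp only [hx]; rw [inv_pow, rootBranch_pow hk0 hρ0.le, hcp]
    rw [hpow]
    field_simp
  · have h0 : Tendsto (x i) (Bornology.cobounded ℂ) (𝓝 0) := by
      rw [tendsto_zero_iff_norm_tendsto_zero]
      simp only [hxn]
      exact ((tendsto_mul_rpow_inv_atTop hk0 hρ0).comp
        tendsto_norm_cobounded_atTop).inv_tendsto_atTop
    have hψc : ContinuousAt ψ 0 := hcont.continuousAt (Metric.ball_mem_nhds 0 hδ)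
    have := hψc.tendsto.comp h0
    rwa [hψ0] at this
  · exact isSimpleClosedCurve_comp_polarPt (htpos r hr) (hcont.mono (hsphere r hr))
      (hinj.mono (hsphere r hr))
  · rw [curveTrace_comp_polarPt ψ (htpos r hr)]
    have himg := rootBranch_image (α := α) hk0 hρ0 (hR.trans hr)
    ext z
    constructor
    · rintro ⟨y, hy, rfl⟩
      have hy' : y⁻¹ ∈ Metric.sphere (0 : ℂ) ((r * ρ) ^ (1 / (k : ℝ))) := by
        rw [mem_sphere_zero_iff_norm] at hy ⊢
        rw [norm_inv, hy, inv_inv]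
      rw [← himg] at hy'
      obtain ⟨j, hj, θ, hθ, h⟩ := hy'
      exact ⟨⟨j, hj⟩, θ, hθ, by simp only [hx]; rw [← h, inv_inv]⟩
    · rintro ⟨j, θ, hθ, rfl⟩
      refine ⟨_, ?_, rfl⟩
      rw [mem_sphere_zero_iff_norm, hxn, norm_polarPt (hR.trans hr).le]
  · have hr0 := hR.trans hr
    have ht : r ^ (-1 / (k : ℝ)) * ρ ^ (-1 / (k : ℝ)) = ((r * ρ) ^ (1 / (k : ℝ)))⁻¹ := by
      rw [← Real.mul_rpow hr0.le hρ0.le, neg_div, Real.rpow_neg (mul_pos hr0 hρ0).le]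
    have hmem : polarPt ((r * ρ) ^ (1 / (k : ℝ)))⁻¹ θ ∈ Metric.ball (0 : ℂ) δ := by
      rw [mem_ball_zero_iff, norm_polarPt (htpos r hr).le]
      exact htδ r hr
    rw [ht]
    refine (hclose _ hmem).trans (le_of_eq ?_)
    rw [norm_polarPt (htpos r hr).le, ← ht, mul_pow, ← Real.rpow_natCast, ← Real.rpow_natCast,
      ← Real.rpow_mul hr0.le, ← Real.rpow_mul hρ0.le]
    have : -1 / (k : ℝ) * (2 : ℕ) = -2 / k := by push_cast; ring
    rw [this]
    ring

/-! ### All solutions of `a z = τ b z` for large `τ` -/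

theorem Multiset.map_univ_sumType {α β γ : Type*} [Fintype α] [Fintype β] (f : α ⊕ β → γ) :
    (Finset.univ : Finset (α ⊕ β)).val.map f =
      (Finset.univ : Finset α).val.map (fun i => f (Sum.inl i)) +
        (Finset.univ : Finset β).val.map (fun i => f (Sum.inr i)) := by
  rw [← Finset.univ_disjSum_univ, Finset.val_disjSum, Multiset.map_disjSum]

theorem Multiset.map_univ_equiv {α β γ : Type*} [Fintype α] [Fintype β] (e : α ≃ β) (f : β → γ) :
    (Finset.univ : Finset α).val.map (fun i => f (e i)) =
      (Finset.univ : Finset β).val.map f := by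
  conv_rhs => rw [← Finset.map_univ_equiv e, Finset.map_val, Multiset.map_map]
  rfl

/-- A polynomial with as many distinct known roots as its degree has no others. -/
theorem Polynomial.roots_eq_map_of_injective {ι : Type*} [Fintype ι] {P : ℂ[X]} (hP : P ≠ 0)
    {f : ι → ℂ} (hf : Function.Injective f) (hr : ∀ i, P.IsRoot (f i))
    (hcard : P.natDegree ≤ Fintype.card ι) :
    P.roots = (Finset.univ : Finset ι).val.map f := by
  symm
  refine Multiset.eq_of_le_of_card_le ?_ ?_
  · rw [Multiset.le_iff_subset (Finset.univ.nodup.map hf)]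
    intro z hz
    obtain ⟨i, _, rfl⟩ := Multiset.mem_map.mp hz
    exact (mem_roots hP).mpr (hr i)
  · rw [Multiset.card_map]
    exact (card_roots' P).trans hcard

/-- The roots of `b` repeated according to multiplicity, as an index type. -/
abbrev RootIndex (b : ℂ[X]) : Type :=
  Σ ζ : {ζ // ζ ∈ b.roots.toFinset}, Fin (b.rootMultiplicity (ζ : ℂ))

theorem map_rootIndex (b : ℂ[X]) :
    (Finset.univ : Finset (RootIndex b)).val.map (fun i => (i.1 : ℂ)) = b.roots := by
  have h : (Finset.univ : Finset (RootIndex b)).val.map (fun i => (i.1 : ℂ)) =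
      ∑ i : RootIndex b, {(i.1 : ℂ)} := by
    rw [Finset.sum_eq_multiset_sum, ← Multiset.bind_singleton]; rfl
  rw [h, Fintype.sum_sigma]
  simp only [Finset.sum_const, Finset.card_univ, Fintype.card_fin]
  rw [Finset.univ_eq_attach, Finset.sum_attach b.roots.toFinset
    (fun ζ => b.rootMultiplicity ζ • ({ζ} : Multiset ℂ))]
  conv_rhs => rw [← Multiset.toFinset_sum_count_nsmul_eq b.roots]
  simp only [count_roots]

theorem card_rootIndex (b : ℂ[X]) : Fintype.card (RootIndex b) = b.natDegree := by
  have h := congrArg Multiset.card (map_rootIndex b)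
  rw [Multiset.card_map] at h
  exact h.trans (splits_iff_card_roots.mp (IsAlgClosed.splits b))

/-- Finitely many points have disjoint bounded neighbourhoods. -/
theorem exists_disjoint_nhds_in_ball {Z : Set ℂ} (hZ : Z.Finite) :
    ∃ (M : ℝ) (U : ℂ → Set ℂ), (∀ ζ ∈ Z, U ζ ∈ 𝓝 ζ) ∧ (∀ ζ, U ζ ⊆ Metric.ball 0 M) ∧
      Z.PairwiseDisjoint U := by
  obtain ⟨U, hU, hd⟩ := hZ.t2_separation
  obtain ⟨M, hM⟩ := hZ.isBounded.subset_ball 0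
  refine ⟨M, fun ζ => U ζ ∩ Metric.ball 0 M, fun ζ hζ => ?_, fun ζ => inter_subset_right,
    hd.mono fun ζ => inter_subset_left⟩
  exact inter_mem ((hU ζ).2.mem_nhds (hU ζ).1) (Metric.isOpen_ball.mem_nhds (hM hζ))

/-- For large `τ`, the large solutions of `a z = τ b z` and those near the roots of `b` are all
the solutions; they are distinct and trace out disjoint curves. -/
theorem exists_solution_branches {a b : ℂ[X]} (hab : IsCoprime a b) (hb : b ≠ 0) {κ : ℕ}
    (hdeg : a.natDegree = b.natDegree + (κ + 1)) {w : ℂ} {ρ α : ℝ} (hρ : 0 < ρ)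
    (hlead : b.leadingCoeff / a.leadingCoeff = w) (hw : w = polarPt ρ α) :
    ∃ (R K : ℝ) (lam : Fin (κ + 1) → ℂ → ℂ) (mu : RootIndex b → ℂ → ℂ)
      (Γinf : ℝ → ℝ → ℂ) (Γ : ℂ → ℝ → ℝ → ℂ), 0 < R ∧
      (∀ τ : ℂ, R < ‖τ‖ → (a - C τ * b).roots =
        Multiset.map (fun j => lam j τ) Finset.univ.val +
          Multiset.map (fun i => mu i τ) Finset.univ.val) ∧
      (∀ i, Tendsto (mu i) (Bornology.cobounded ℂ) (𝓝 (i.1 : ℂ))) ∧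
      (∀ j : Fin (κ + 1), ∀ r > R, ∀ θ ∈ Ico (0 : ℝ) (2 * Real.pi),
        ‖lam j (polarPt r θ) - polarPt ((r * ρ) ^ (1 / ((κ : ℝ) + 1)))
          (1 / ((κ : ℝ) + 1) * (θ + α) + 2 * ((j : ℝ) + 1) / ((κ : ℝ) + 1) * Real.pi)‖ ≤ K) ∧
      (∀ j : Fin (κ + 1), ∀ r > R, ∀ θ ∈ Ico (0 : ℝ) (2 * Real.pi), ∃ D : ℂ,
        (0 < θ → HasDerivAt (lam j) D (polarPt r θ)) ∧
        (θ = 0 → HasDerivWithinAt (lam j) D {z : ℂ | 0 ≤ z.im} (polarPt r θ)) ∧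
        ‖D - w / (((κ : ℂ) + 1) * lam j (polarPt r θ) ^ κ)‖ ≤
          K * (‖lam j (polarPt r θ)‖ ^ (κ + 1))⁻¹) ∧
      (∀ r > R, IsSimpleClosedCurve (Γinf r) ∧
        curveTrace (Γinf r) =
          {z | ∃ j, ∃ θ ∈ Ico (0 : ℝ) (2 * Real.pi), z = lam j (polarPt r θ)} ∧
        ∀ θ ∈ Icc (0 : ℝ) (2 * Real.pi),
          ‖Γinf r θ - polarPt ((r * ρ) ^ (1 / ((κ : ℝ) + 1))) θ‖ ≤ K) ∧
      (∀ j : Fin (κ + 1), ∀ r > R,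
        Tendsto (fun θ : ℝ => lam j (polarPt r θ)) (𝓝[<] (2 * Real.pi))
          (𝓝 (lam (j + 1) (r : ℂ)))) ∧
      (∀ ζ ∈ b.roots, ∀ (k : ℕ) (ρ' : ℝ), k = b.rootMultiplicity ζ →
        ρ' = ‖(b /ₘ (X - C ζ) ^ k).eval ζ / a.eval ζ‖ → 0 < ρ' ∧
        ∀ r > R, IsSimpleClosedCurve (Γ ζ r) ∧
          curveTrace (Γ ζ r) = {z | ∃ i : RootIndex b, (i.1 : ℂ) = ζ ∧
            ∃ θ ∈ Ico (0 : ℝ) (2 * Real.pi), z = mu i (polarPt r θ)} ∧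
          ∀ θ ∈ Icc (0 : ℝ) (2 * Real.pi),
            ‖Γ ζ r θ - (ζ + polarPt (r ^ (-1 / (k : ℝ)) * ρ' ^ (-1 / (k : ℝ))) θ)‖ ≤
              K * r ^ (-2 / (k : ℝ))) ∧
      (∀ r > R, (∀ ζ ∈ b.roots, Disjoint (curveTrace (Γinf r)) (curveTrace (Γ ζ r))) ∧
        ∀ ζ ∈ b.roots, ∀ ζ' ∈ b.roots, ζ ≠ ζ' →
          Disjoint (curveTrace (Γ ζ r)) (curveTrace (Γ ζ' r))) := by
  obtain ⟨M, U, hU, hUM, hUd⟩ := exists_disjoint_nhds_in_ball (b.roots.toFinset.finite_toSet)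
  obtain ⟨R₀, K₀, lam, Γinf, hR₀, hlinj, hlroot, hlas, hlder, hlcurve, hlcyc⟩ :=
    exists_large_branches hb hdeg hρ hlead hw M
  have hroot : ∀ ζ : {ζ // ζ ∈ b.roots.toFinset}, b.IsRoot ζ := fun ζ =>
    isRoot_of_mem_roots (Multiset.mem_toFinset.mp ζ.2)
  have hane : ∀ ζ : {ζ // ζ ∈ b.roots.toFinset}, a.eval (ζ : ℂ) ≠ 0 := fun ζ h => by
    obtain ⟨x, y, hxy⟩ := hab
    have := congrArg (eval (ζ : ℂ)) hxy
    simp [h, (hroot ζ).eq_zero] at this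
  choose R₁ K₁ mu Γ hρ₁ hR₁ hminj hmroot hmlim hmcurve using fun ζ : {ζ // ζ ∈ b.roots.toFinset} =>
    exists_bounded_branches (hane ζ) hb (hroot ζ) (hU ζ ζ.2) rfl rfl
  classical
  set R := R₀ + ∑ ζ, R₁ ζ with hR
  set K := |K₀| + ∑ ζ, |K₁ ζ| with hK
  have hR0 : R₀ ≤ R := le_add_of_nonneg_right (Finset.sum_nonneg fun ζ _ => (hR₁ ζ).le)
  have hR1 : ∀ ζ, R₁ ζ ≤ R := fun ζ => by
    have := Finset.single_le_sum (fun ζ _ => (hR₁ ζ).le) (Finset.mem_univ ζ)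
    linarith
  have hK0 : K₀ ≤ K :=
    (le_abs_self K₀).trans (le_add_of_nonneg_right (Finset.sum_nonneg fun ζ _ => abs_nonneg _))
  have hK1 : ∀ ζ, K₁ ζ ≤ K := fun ζ => by
    have := Finset.single_le_sum (fun ζ _ => abs_nonneg (K₁ ζ)) (Finset.mem_univ ζ)
    linarith [le_abs_self (K₁ ζ), abs_nonneg K₀]
  have hRpos : 0 < R := hR₀.trans_le hR0
  have hpn : ∀ r > R, ∀ θ, R < ‖polarPt r θ‖ := fun r hr θ => by
    rwa [norm_polarPt (hRpos.trans hr).le]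
  have hlamU : ∀ τ : ℂ, R < ‖τ‖ → ∀ j ζ, lam j τ ∉ U ζ := fun τ hτ j ζ h => by
    have h1 := (hlroot τ (hR0.trans_lt hτ) j).1
    have h2 := mem_ball_zero_iff.mp (hUM ζ h)
    linarith
  -- the curves at points which are not roots of `b` play no role
  set Γ' : ℂ → ℝ → ℝ → ℂ := fun ζ => if h : ζ ∈ b.roots.toFinset then Γ ⟨ζ, h⟩ else 0 with hΓ'
  have hΓ : ∀ ζ : {ζ // ζ ∈ b.roots.toFinset}, Γ' ζ = Γ ζ := fun ζ => by
    simp only [hΓ', dif_pos ζ.2]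
  have htrace : ∀ (ζ : {ζ // ζ ∈ b.roots.toFinset}), ∀ r > R, curveTrace (Γ' ζ r) ⊆ U ζ := by
    intro ζ r hr z hz
    rw [hΓ, (hmcurve ζ r ((hR1 ζ).trans_lt hr)).2.1] at hz
    obtain ⟨i, θ, _, rfl⟩ := hz
    exact (hmroot ζ _ ((hR1 ζ).trans_lt (hpn r hr θ)) i).1
  refine ⟨R, K, lam, fun i => mu i.1 i.2, Γinf, Γ', hRpos, fun τ hτ => ?_, fun i => hmlim i.1 i.2,
    fun j r hr θ hθ => (hlas j r (hR0.trans_lt hr) θ hθ).trans hK0, fun j r hr θ hθ => ?_,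
    fun r hr => ?_, fun j r hr => hlcyc j r (hR0.trans_lt hr), fun ζ hζ k ρ' hk hρ' => ?_,
    fun r hr => ⟨fun ζ hζ => ?_, fun ζ hζ ζ' hζ' hne => ?_⟩⟩
  · have hdlt : (C τ * b).degree < a.degree :=
      degree_lt_degree ((natDegree_C_mul_le τ b).trans_lt (by omega))
    have hnat : (a - C τ * b).natDegree = a.natDegree :=
      natDegree_eq_of_degree_eq (degree_sub_eq_left_of_degree_lt hdlt)
    have hne : a - C τ * b ≠ 0 := fun h => by
      rw [h, natDegree_zero] at hnat; omega
    set f : Fin (κ + 1) ⊕ RootIndex b → ℂ :=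
      Sum.elim (fun j => lam j τ) (fun i => mu i.1 i.2 τ) with hf
    have hmU : ∀ i : RootIndex b, mu i.1 i.2 τ ∈ U i.1 := fun i =>
      (hmroot i.1 τ ((hR1 i.1).trans_lt hτ) i.2).1
    have hinj : Function.Injective f := by
      rintro (j | i) (j' | i') h
      · exact congrArg Sum.inl (hlinj τ (hR0.trans_lt hτ) h)
      · exact absurd (show lam j τ ∈ U i'.1 by rw [show lam j τ = _ from h]; exact hmU i')
          (hlamU τ hτ j _)
      · exact absurd (show lam j' τ ∈ U i.1 by rw [← show _ = lam j' τ from h]; exact hmU i)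
          (hlamU τ hτ j' _)
      · obtain ⟨ζ, i⟩ := i
        obtain ⟨ζ', i'⟩ := i'
        have h' : mu ζ i τ = mu ζ' i' τ := h
        have hζ : ζ = ζ' := by
          by_contra hc
          have hd := hUd ζ.2 ζ'.2 (fun h => hc (Subtype.ext h))
          exact Set.disjoint_left.mp hd (hmU ⟨ζ, i⟩) (by rw [h']; exact hmU ⟨ζ', i'⟩)
        subst hζ
        rw [hminj ζ τ ((hR1 ζ).trans_lt hτ) h']
    have hz : ∀ i, (a - C τ * b).IsRoot (f i) := by
      rintro (j | i)
      · have := (hlroot τ (hR0.trans_lt hτ) j).2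
        simp only [hf, Sum.elim_inl, IsRoot, eval_sub, eval_mul, eval_C, this, sub_self]
      · have := (hmroot i.1 τ ((hR1 i.1).trans_lt hτ) i.2).2
        simp only [hf, Sum.elim_inr, IsRoot, eval_sub, eval_mul, eval_C, this, sub_self]
    have hcard : (a - C τ * b).natDegree ≤ Fintype.card (Fin (κ + 1) ⊕ RootIndex b) := by
      rw [Fintype.card_sum, card_rootIndex, Fintype.card_fin, hnat, hdeg, add_comm]
    rw [roots_eq_map_of_injective hne hinj hz hcard, Multiset.map_univ_sumType]
    rfl
  · obtain ⟨D, h1, h2, h3⟩ := hlder j r (hR0.trans_lt hr) θ hθ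
    exact ⟨D, h1, h2, h3.trans (by gcongr)⟩
  · obtain ⟨h1, h2, h3⟩ := hlcurve r (hR0.trans_lt hr)
    exact ⟨h1, h2, fun θ hθ => (h3 θ hθ).trans hK0⟩
  · subst hk hρ'
    lift ζ to {ζ // ζ ∈ b.roots.toFinset} using Multiset.mem_toFinset.mpr hζ
    refine ⟨hρ₁ ζ, fun r hr => ?_⟩
    obtain ⟨h1, h2, h3⟩ := hmcurve ζ r ((hR1 ζ).trans_lt hr)
    rw [hΓ]
    refine ⟨h1, ?_, fun θ hθ => (h3 θ hθ).trans ?_⟩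
    · rw [h2]
      ext z
      constructor
      · rintro ⟨i, θ, hθ, rfl⟩
        exact ⟨⟨ζ, i⟩, rfl, θ, hθ, rfl⟩
      · rintro ⟨⟨ζ', i⟩, hi, θ, hθ, rfl⟩
        obtain rfl : ζ' = ζ := Subtype.ext hi
        exact ⟨i, θ, hθ, rfl⟩
    · have := hRpos.trans hr
      gcongr
      exact hK1 ζ
  · lift ζ to {ζ // ζ ∈ b.roots.toFinset} using Multiset.mem_toFinset.mpr hζ
    rw [Set.disjoint_left]
    intro z hz hz'
    rw [(hlcurve r (hR0.trans_lt hr)).2.1] at hz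
    obtain ⟨j, θ, _, rfl⟩ := hz
    exact hlamU _ (hpn r hr θ) j ζ (htrace ζ r hr hz')
  · lift ζ to {ζ // ζ ∈ b.roots.toFinset} using Multiset.mem_toFinset.mpr hζ
    lift ζ' to {ζ // ζ ∈ b.roots.toFinset} using Multiset.mem_toFinset.mpr hζ'
    exact (hUd ζ.2 ζ'.2 hne).mono (htrace ζ r hr) (htrace ζ' r hr)

/-! ### Eigenvalues of `A + τ u v*` -/

theorem exists_coprime_factors {m p : ℂ[X]} (hp : p ≠ 0) :
    ∃ g a b : ℂ[X], IsCoprime a b ∧ m = g * a ∧ p = g * b := by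
  have hg : EuclideanDomain.gcd m p ≠ 0 := fun h => hp (EuclideanDomain.gcd_eq_zero_iff.mp h).2
  obtain ⟨a, ha⟩ := EuclideanDomain.gcd_dvd_left m p
  obtain ⟨b, hb⟩ := EuclideanDomain.gcd_dvd_right m p
  refine ⟨EuclideanDomain.gcd m p, a, b, ⟨EuclideanDomain.gcdA m p, EuclideanDomain.gcdB m p, ?_⟩,
    ha, hb⟩
  refine mul_left_cancel₀ hg ?_
  have h := EuclideanDomain.gcd_eq_gcd_ab m p
  calc _ = EuclideanDomain.gcd m p * a * EuclideanDomain.gcdA m p +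
        EuclideanDomain.gcd m p * b * EuclideanDomain.gcdB m p := by ring
    _ = _ := by rw [← ha, ← hb, ← h, mul_one]

theorem mainTheorem2 {n : ℕ} (A : Matrix (Fin n) (Fin n) ℂ) (u v : Fin n → ℂ)
    (l : ℕ) (hl : l = (minpoly ℂ A).natDegree)
    (κ : ℕ) (hκ : κ < l)
    (hzero : ∀ j < κ, starForm v (A ^ j) u = 0)
    (hne : starForm v (A ^ κ) u ≠ 0)
    (rκ θκ : ℝ) (hrκ : 0 ≤ rκ) (hpolar : starForm v (A ^ κ) u = polarPt rκ θκ) :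
    -- (i)
    (puv A u v).degree = ((l - κ - 1 : ℕ) : WithBot ℕ) ∧
    ∃ (R K : ℝ) (lam : Fin (κ + 1) → ℂ → ℂ) (mu : Fin (l - κ - 1) → ℂ → ℂ)
      (root : Fin (l - κ - 1) → ℂ) (Γinf : ℝ → ℝ → ℂ) (Γ : ℂ → ℝ → ℝ → ℂ),
      0 < R ∧
      -- for large `τ`, the `lam j τ`, the `mu i τ` and the `n - l` zeros of
      -- `det (z - A) / m_A(z)` are all the eigenvalues of `B(τ)`, with multiplicities
      (∀ τ : ℂ, R < ‖τ‖ → (rankOnePert A u v τ).charpoly.roots =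
        (A.charpoly /ₘ minpoly ℂ A).roots +
          Multiset.map (fun j => lam j τ) Finset.univ.val +
          Multiset.map (fun i => mu i τ) Finset.univ.val) ∧
      -- (ii)
      Multiset.map root Finset.univ.val = (puv A u v).roots ∧
      (∀ i, Tendsto (mu i) (Bornology.cobounded ℂ) (𝓝 (root i))) ∧
      -- (iii), asymptotics of the large eigenvalues
      (∀ j : Fin (κ + 1), ∀ r > R, ∀ θ ∈ Ico (0 : ℝ) (2 * Real.pi),
        ‖lam j (polarPt r θ) - polarPt ((r * rκ) ^ (1 / ((κ : ℝ) + 1)))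
          (1 / ((κ : ℝ) + 1) * (θ + θκ) + 2 * ((j : ℝ) + 1) / ((κ : ℝ) + 1) * Real.pi)‖ ≤ K) ∧
      -- (iii), asymptotics of their derivatives, which on the positive half-line, where the
      -- branches `0 ≤ θ < 2π` are cut, are taken from the side of `θ > 0`
      (∀ j : Fin (κ + 1), ∀ r > R, ∀ θ ∈ Ico (0 : ℝ) (2 * Real.pi), ∃ D : ℂ,
        (0 < θ → HasDerivAt (lam j) D (polarPt r θ)) ∧
        (θ = 0 → HasDerivWithinAt (lam j) D {z : ℂ | 0 ≤ z.im} (polarPt r θ)) ∧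
        ‖D - starForm v (A ^ κ) u / (((κ : ℂ) + 1) * lam j (polarPt r θ) ^ κ)‖ ≤
          K * (‖lam j (polarPt r θ)‖ ^ (κ + 1))⁻¹) ∧
      -- (iii) and (v), the curve traced out by the large eigenvalues
      (∀ r > R, IsSimpleClosedCurve (Γinf r) ∧
        curveTrace (Γinf r) =
          {z | ∃ j, ∃ θ ∈ Ico (0 : ℝ) (2 * Real.pi), z = lam j (polarPt r θ)} ∧
        ∀ θ ∈ Icc (0 : ℝ) (2 * Real.pi),
          ‖Γinf r θ - polarPt ((r * rκ) ^ (1 / ((κ : ℝ) + 1))) θ‖ ≤ K) ∧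
      -- (iv), where `j + 1` is taken cyclically
      (∀ j : Fin (κ + 1), ∀ r > R,
        Tendsto (fun θ : ℝ => lam j (polarPt r θ)) (𝓝[<] (2 * Real.pi))
          (𝓝 (lam (j + 1) (r : ℂ)))) ∧
      -- (v), the curves traced out by the eigenvalues near the roots of `p_{uv}`
      (∀ ζ ∈ freeRoots A u v, 0 < rhoAt A u v ζ ∧
        ∀ r > R, IsSimpleClosedCurve (Γ ζ r) ∧
          curveTrace (Γ ζ r) =
            {z | ∃ i, root i = ζ ∧ ∃ θ ∈ Ico (0 : ℝ) (2 * Real.pi), z = mu i (polarPt r θ)} ∧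
          ∀ θ ∈ Icc (0 : ℝ) (2 * Real.pi),
            ‖Γ ζ r θ - (ζ + polarPt
              (r ^ (-1 / ((puv A u v).rootMultiplicity ζ : ℝ)) *
                rhoAt A u v ζ ^ (-1 / ((puv A u v).rootMultiplicity ζ : ℝ))) θ)‖ ≤
            K * r ^ (-2 / ((puv A u v).rootMultiplicity ζ : ℝ))) ∧
      -- (v), the curves are disjoint
      (∀ r > R, (∀ ζ ∈ freeRoots A u v, Disjoint (curveTrace (Γinf r)) (curveTrace (Γ ζ r))) ∧
        ∀ ζ ∈ freeRoots A u v, ∀ ζ' ∈ freeRoots A u v, ζ ≠ ζ' →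
          Disjoint (curveTrace (Γ ζ r)) (curveTrace (Γ ζ' r))) ∧
      -- (v), together with the structurally frozen eigenvalues, and the eigenvalues that converge
      -- to accidentally frozen ones, if there are any, they make up `σ(A,u,v;r)`
      (∀ r > R, sigmaSet A u v r =
        curveTrace (Γinf r) ∪ (⋃ ζ ∈ freeRoots A u v, curveTrace (Γ ζ r)) ∪
          {z | z ∈ (A.charpoly /ₘ minpoly ℂ A).roots} ∪
          {z | ∃ i, root i ∈ spectrum ℂ A ∧
            ∃ θ ∈ Ico (0 : ℝ) (2 * Real.pi), z = mu i (polarPt r θ)}) := by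
  set m := minpoly ℂ A with hm
  set p := puv A u v with hp
  have hmonic : m.Monic := minpoly.monic (Matrix.isIntegral A)
  have hm0 : m ≠ 0 := hmonic.ne_zero
  obtain ⟨hpdeg, hplead⟩ := natDegree_puv_and_leadingCoeff (hl ▸ hκ) hzero hne
  rw [← hm, ← hl, ← hp] at hpdeg
  rw [← hp] at hplead
  have hp0 : p ≠ 0 := by
    rw [← leadingCoeff_ne_zero, hplead]; exact hne
  refine ⟨by rw [degree_eq_natDegree hp0, hpdeg], ?_⟩
  have hrκ0 : 0 < rκ := by
    refine lt_of_le_of_ne hrκ fun h => hne ?_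
    rw [hpolar, ← h, polarPt, Complex.ofReal_zero, zero_mul]
  -- split off the common roots of `m` and `p`, which do not move with `τ`
  obtain ⟨g, a, b, hab, hma, hpb⟩ := exists_coprime_factors (m := m) hp0
  have hg0 : g ≠ 0 := by rintro rfl; exact hm0 (by rw [hma, zero_mul])
  have ha0 : a ≠ 0 := by rintro rfl; exact hm0 (by rw [hma, mul_zero])
  have hb0 : b ≠ 0 := by rintro rfl; exact hp0 (by rw [hpb, mul_zero])
  have hmdeg : g.natDegree + a.natDegree = l := by rw [hl, ← natDegree_mul hg0 ha0, ← hma]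
  have hpdeg' : g.natDegree + b.natDegree = l - κ - 1 := by
    rw [← hpdeg, hpb, natDegree_mul hg0 hb0]
  have hdeg : a.natDegree = b.natDegree + (κ + 1) := by omega
  have hlead : b.leadingCoeff / a.leadingCoeff = starForm v (A ^ κ) u := by
    have h1 : g.leadingCoeff * a.leadingCoeff = 1 := by
      rw [← leadingCoeff_mul, ← hma, hmonic.leadingCoeff]
    rw [div_eq_iff (leadingCoeff_ne_zero.mpr ha0), ← hplead, hpb, leadingCoeff_mul]
    linear_combination -b.leadingCoeff * h1
  obtain ⟨R, K, lam, mu, Γinf, Γ, hR, hroots, hlim, hasymp, hder, hinf, hcyc, hcurve, hdisj⟩ :=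
    exists_solution_branches hab hb0 hdeg hrκ0 hlead hpolar
  have hspec : ∀ ζ, g.IsRoot ζ → ζ ∈ spectrum ℂ A := fun ζ h => by
    by_contra hc
    exact eval_minpoly_ne_zero A hc (h.dvd ⟨a, hma⟩)
  have hfree : ∀ ζ ∈ freeRoots A u v, g.eval ζ ≠ 0 ∧ ζ ∈ b.roots := fun ζ hζ => by
    have hgζ : g.eval ζ ≠ 0 := fun h => hζ.2 (hspec ζ h)
    refine ⟨hgζ, (mem_roots hb0).mpr ?_⟩
    have h := isRoot_of_mem_roots hζ.1
    rw [← hp, hpb, IsRoot, eval_mul] at h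
    exact (mul_eq_zero.mp h).resolve_left hgζ
  -- the eigenvalues `mu` are the roots of `g`, constant in `τ`, and the solutions near the roots
  -- of `b`
  have hcard : Fintype.card (Fin (l - κ - 1)) = Fintype.card (g.roots ⊕ RootIndex b) := by
    rw [Fintype.card_fin, Fintype.card_sum, card_rootIndex, Multiset.card_coe,
      splits_iff_card_roots.mp (IsAlgClosed.splits g), hpdeg']
  set e := Fintype.equivOfCardEq hcard with he
  set root : g.roots ⊕ RootIndex b → ℂ := Sum.elim (fun x => x.1) (fun i => i.1) with hroot
  set mu' : g.roots ⊕ RootIndex b → ℂ → ℂ := Sum.elim (fun x _ => x.1) mu with hmu'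
  have hrootsp : Multiset.map (fun i => root (e i)) Finset.univ.val = p.roots := by
    rw [Multiset.map_univ_equiv e root, Multiset.map_univ_sumType, hpb,
      roots_mul (hpb ▸ hp0)]
    exact congrArg₂ (· + ·) (Multiset.map_univ_coe g.roots) (map_rootIndex b)
  have hchar : ∀ τ : ℂ, R < ‖τ‖ → (rankOnePert A u v τ).charpoly.roots =
      (A.charpoly /ₘ m).roots + Multiset.map (fun j => lam j τ) Finset.univ.val +
        Multiset.map (fun i => mu' (e i) τ) Finset.univ.val := by
    intro τ hτ
    have hmon : (rankOnePert A u v τ).charpoly ≠ 0 := (charpoly_monic _).ne_zero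
    have hfac := charpoly_rankOnePert A u v τ
    rw [← hm, ← hp, show m - Polynomial.C τ * p = g * (a - Polynomial.C τ * b) by
      rw [hma, hpb]; ring] at hfac
    have hne' : g * (a - Polynomial.C τ * b) ≠ 0 := fun h => hmon (by rw [hfac, h, mul_zero])
    have hmumap : Multiset.map (fun i => mu' (e i) τ) Finset.univ.val =
        g.roots + Multiset.map (fun i => mu i τ) Finset.univ.val := by
      rw [Multiset.map_univ_equiv e (fun i => mu' i τ), Multiset.map_univ_sumType]
      exact congrArg (· + _) (Multiset.map_univ_coe g.roots)
    rw [hmumap, hfac, roots_mul (hfac ▸ hmon), roots_mul hne', hroots τ hτ]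
    abel
  have htr : ∀ ζ ∈ freeRoots A u v, ∀ r, {z | ∃ i : RootIndex b, (i.1 : ℂ) = ζ ∧
      ∃ θ ∈ Ico (0 : ℝ) (2 * Real.pi), z = mu i (polarPt r θ)} =
      {z | ∃ i, root (e i) = ζ ∧
        ∃ θ ∈ Ico (0 : ℝ) (2 * Real.pi), z = mu' (e i) (polarPt r θ)} := by
    intro ζ hζ r
    ext z
    constructor
    · rintro ⟨i, hi, θ, hθ, rfl⟩
      exact ⟨e.symm (Sum.inr i), by rw [e.apply_symm_apply]; exact hi, θ, hθ,
        by rw [e.apply_symm_apply]; rfl⟩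
    · rintro ⟨i, hi, θ, hθ, rfl⟩
      rcases h : e i with x | i'
      · rw [h] at hi
        have hx : g.IsRoot x.1 := isRoot_of_mem_roots Multiset.coe_mem
        rw [show x.1 = ζ from hi] at hx
        exact absurd hx (hfree ζ hζ).1
      · rw [h] at hi
        exact ⟨i', hi, θ, hθ, rfl⟩
  have hcurve' : ∀ ζ ∈ freeRoots A u v, 0 < rhoAt A u v ζ ∧
      ∀ r > R, IsSimpleClosedCurve (Γ ζ r) ∧
        curveTrace (Γ ζ r) = {z | ∃ i, root (e i) = ζ ∧
          ∃ θ ∈ Ico (0 : ℝ) (2 * Real.pi), z = mu' (e i) (polarPt r θ)} ∧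
        ∀ θ ∈ Icc (0 : ℝ) (2 * Real.pi),
          ‖Γ ζ r θ - (ζ + polarPt (r ^ (-1 / (p.rootMultiplicity ζ : ℝ)) *
            rhoAt A u v ζ ^ (-1 / (p.rootMultiplicity ζ : ℝ))) θ)‖ ≤
            K * r ^ (-2 / (p.rootMultiplicity ζ : ℝ)) := by
    intro ζ hζ
    obtain ⟨hgζ, hbζ⟩ := hfree ζ hζ
    have hmult : p.rootMultiplicity ζ = b.rootMultiplicity ζ := by
      rw [hpb, rootMultiplicity_mul (hpb ▸ hp0), rootMultiplicity_eq_zero hgζ, zero_add]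
    have hrho : rhoAt A u v ζ =
        ‖(b /ₘ (X - Polynomial.C ζ) ^ p.rootMultiplicity ζ).eval ζ / a.eval ζ‖ := by
      have hdiv : p /ₘ (X - Polynomial.C ζ) ^ p.rootMultiplicity ζ =
          g * (b /ₘ (X - Polynomial.C ζ) ^ p.rootMultiplicity ζ) := by
        have h1 := pow_mul_divByMonic_rootMultiplicity_eq p ζ
        have h2 := pow_mul_divByMonic_rootMultiplicity_eq b ζ
        rw [← hmult] at h2
        refine mul_left_cancel₀ (pow_ne_zero (p.rootMultiplicity ζ) (X_sub_C_ne_zero ζ)) ?_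
        rw [h1, mul_left_comm, h2, ← hpb]
      rw [← norm_div_eq_rhoAt A u v hζ.2, ← hp, hdiv, ← hm, hma, eval_mul, eval_mul,
        mul_div_mul_left _ _ hgζ]
    obtain ⟨h1, h2⟩ := hcurve ζ hbζ _ _ hmult hrho
    refine ⟨h1, fun r hr => ?_⟩
    obtain ⟨h3, h4, h5⟩ := h2 r hr
    exact ⟨h3, h4.trans (htr ζ hζ r), h5⟩
  refine ⟨R, K, lam, fun i => mu' (e i), fun i => root (e i), Γinf, Γ, hR, hchar, hrootsp,
    fun i => ?_, hasymp, hder, hinf, hcyc, hcurve', fun r hr =>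
    ⟨fun ζ hζ => (hdisj r hr).1 ζ (hfree ζ hζ).2, fun ζ hζ ζ' hζ' h =>
      (hdisj r hr).2 ζ (hfree ζ hζ).2 ζ' (hfree ζ' hζ').2 h⟩, fun r hr => ?_⟩
  · rcases h : e i with x | i' <;> simp only [h]
    · exact tendsto_const_nhds
    · exact hlim i'
  · have hpn : ∀ θ, R < ‖polarPt r θ‖ := fun θ => by rwa [norm_polarPt (hR.trans hr).le]
    have hmemsp : ∀ θ z, z ∈ spectrum ℂ (rankOnePert A u v (polarPt r θ)) ↔
        z ∈ (A.charpoly /ₘ m).roots ∨ (∃ j, lam j (polarPt r θ) = z) ∨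
          ∃ i, mu' (e i) (polarPt r θ) = z := fun θ z => by
      rw [mem_spectrum_iff_isRoot_charpoly, ← mem_roots (charpoly_monic _).ne_zero,
        hchar _ (hpn θ), Multiset.mem_add, Multiset.mem_add, Multiset.mem_map, Multiset.mem_map]
      simp only [Finset.mem_val, Finset.mem_univ, true_and, or_assoc]
    have hrootmem : ∀ i, root (e i) ∈ p.roots := fun i => by
      rw [← hrootsp]
      exact Multiset.mem_map_of_mem (fun i => root (e i)) (Finset.mem_univ_val i)
    ext z
    simp only [sigmaSet, mem_iUnion, mem_union, mem_ofPred_eq, exists_prop]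
    rw [(hinf r hr).2.1]
    constructor
    · rintro ⟨θ, hθ, hz⟩
      rcases (hmemsp θ z).mp hz with h | ⟨j, rfl⟩ | ⟨i, rfl⟩
      · exact Or.inl (Or.inr h)
      · exact Or.inl (Or.inl (Or.inl ⟨j, θ, hθ, rfl⟩))
      · by_cases hs : root (e i) ∈ spectrum ℂ A
        · exact Or.inr ⟨i, hs, θ, hθ, rfl⟩
        · have hζ : root (e i) ∈ freeRoots A u v := ⟨hrootmem i, hs⟩
          refine Or.inl (Or.inl (Or.inr ⟨root (e i), hζ, ?_⟩))
          rw [((hcurve' _ hζ).2 r hr).2.1]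
          exact ⟨i, rfl, θ, hθ, rfl⟩
    · rintro (((⟨j, θ, hθ, rfl⟩ | ⟨ζ, hζ, hz⟩) | h) | ⟨i, _, θ, hθ, rfl⟩)
      · exact ⟨θ, hθ, (hmemsp θ _).mpr (Or.inr (Or.inl ⟨j, rfl⟩))⟩
      · rw [((hcurve' _ hζ).2 r hr).2.1] at hz
        obtain ⟨i, _, θ, hθ, rfl⟩ := hz
        exact ⟨θ, hθ, (hmemsp θ _).mpr (Or.inr (Or.inr ⟨i, rfl⟩))⟩
      · exact ⟨0, ⟨le_rfl, Real.two_pi_pos⟩, (hmemsp 0 z).mpr (Or.inl h)⟩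
      · exact ⟨θ, hθ, (hmemsp θ _).mpr (Or.inr (Or.inr ⟨i, rfl⟩))⟩
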